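/- Let $R$ be an associative (not necessarily commutative) ring with identity $1\neq 0$, and let $E=(E^0,E^1,s,r)$ be a finite directed graph with at least one vertex ($E^0$ is finite and non-empty, $E^1$ is finite). A path of length $n\ge 1$ is a sequence of edges $f_1f_2\cdots f_n$ with $s(f_{i+1})=r(f_i)$ for $1\le i\le n-1$; vertices are the paths of length $0$. A cycle is a path $f_1\cdots f_n$ with $n\ge 1$, $s(f_1)=r(f_n)$ and $s(f_i)\ne s(f_1)$ for $2\le i\le n$; an exit of it is an edge $e$ such that $s(e)=s(f_i)$ and $e\neq f_i$ for some $i$. Assume that $E$ satisfies Condition (NE): no cycle of $E$ has an exit. Let $L_R(E)$ be the Leavitt path algebra of $E$ with coefficients in $R$, that is, the (not a priori unital) $R$-algebra generated by symbols $v$ ($v\in E^0$), $f$ and $f^*$ ($f\in E^1$), which commute with the elements of $R$, subject to the relations (a) $vw=\delta_{v,w}v$ for $v,w\in E^0$; (b) $s(f)f=fr(f)=f$ and $r(f)f^*=f^*s(f)=f^*$ for $f\in E^1$; (c) $f^*g=\delta_{f,g}r(f)$ for $f,g\in E^1$; (d) $\sum_{f\in E^1,\,s(f)=v}ff^*=v$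 for every $v\in E^0$ for which $s^{-1}(v)$ is non-empty and finite. Let $(L_R(E))_0$ be the component of degree $0$ of its canonical $\mathbb{Z}$-grading, that is, the set of finite sums of elements $t\,\alpha\beta^*$ with $t\in R$ and $\alpha,\beta$ paths with $r(\alpha)=r(\beta)$ and $\mathrm{len}(\alpha)=\mathrm{len}(\beta)$; here $(f_1\cdots f_n)^*=f_n^*\cdots f_1^*$, and $v^*=v$ for a vertex $v$. It is a ring with identity $\sum_{v\in E^0}v$. Then $(L_R(E))_0$ is Morita equivalent to $R^k$ for some integer $k>0$ (their categories of left modules are equivalent), and moreover: (a) $R$ is semisimple if and only if $(L_R(E))_0$ is semisimple. (b) $R$ is von Neumann regular if and only if $(L_R(E))_0$ is von Neumann regular. (c) $R$ is left (respectively right) noetherian if and only if $(L_R(E))_0$ is left (respectively right) noetherian. (d) $R$ is left (respectively right) artinian if and only if $(L_R(E))_0$ is left (respectively right) artinian. -/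

import Mathlib

universe u v w

/-- A directed graph `(E⁰, E¹, s, r)` with vertex set `V = E⁰` and edge set `E = E¹`. -/
structure DirectedGraph (V : Type v) (E : Type w) where
  /-- the source of an edge -/
  src : E → V
  /-- the range of an edge -/
  rng : E → V

namespace DirectedGraph

variable {V : Type v} {E : Type w} (G : DirectedGraph V E)

/-- `G.IsPath a l b`: the list of edges `l` is a path with source `a` and range `b`.
The empty list represents the vertex `a = b`, a path of length zero. -/
def IsPath : V → List E → V → Prop
  | a, [], b => a = b
  | a, e :: l, b => G.src e = a ∧ IsPath (G.rng e) l b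

/-- A cycle is a path `f₁ f₂ ⋯ fₙ` with `n ≥ 1`, `s(f₁) = r(fₙ)` and `s(fᵢ) ≠ s(f₁)` for
`2 ≤ i ≤ n`. -/
def IsCycle (l : List E) : Prop :=
  l ≠ [] ∧ ∃ a : V, G.IsPath a l a ∧ ∀ f ∈ l.tail, G.src f ≠ a

/-- An exit of `f₁ f₂ ⋯ fₙ` is an edge `e` such that, for some `i`, `s(e) = s(fᵢ)` and `e ≠ fᵢ`. -/
def IsExit (l : List E) (e : E) : Prop :=
  ∃ f ∈ l, G.src e = G.src f ∧ e ≠ f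

/-- Condition (NE): there is no cycle with an exit. -/
def ConditionNE : Prop :=
  ¬ ∃ (l : List E) (e : E), G.IsCycle l ∧ G.IsExit l e

end DirectedGraph

/-- The generating symbols of the Leavitt path algebra: vertices `v`, real edges `f` and ghost
edges `f*`. -/
inductive LeavittGen (V : Type v) (E : Type w) : Type (max v w)
  | vert (a : V)
  | edge (e : E)
  | ghost (e : E)

/-- The non-unital ring of finite `R`-linear combinations of non-empty words in the symbols, in
which coefficients commute with the symbols: the free (non-unital) `R`-algebra on the symbols. -/
abbrev LeavittFree (R : Type u) [Ring R] (V : Type v) (E : Type w) : Type (max u v w) :=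
  MonoidAlgebra R (FreeSemigroup (LeavittGen V E))

namespace LeavittFree

/-- A symbol, as a word of length one. -/
abbrev vert {V : Type v} {E : Type w} (a : V) : FreeSemigroup (LeavittGen V E) :=
  FreeSemigroup.of (LeavittGen.vert a)

/-- A symbol, as a word of length one. -/
abbrev edge {V : Type v} {E : Type w} (e : E) : FreeSemigroup (LeavittGen V E) :=
  FreeSemigroup.of (LeavittGen.edge e)

/-- A symbol, as a word of length one. -/
abbrev ghost {V : Type v} {E : Type w} (e : E) : FreeSemigroup (LeavittGen V E) :=
  FreeSemigroup.of (LeavittGen.ghost e)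

end LeavittFree

namespace DirectedGraph

open LeavittFree MonoidAlgebra

variable {V : Type v} {E : Type w} (G : DirectedGraph V E)

/-- The defining relations of the Leavitt path algebra. Each of them is imposed together with all
its multiples by coefficients `t`, since the free algebra has no identity. -/
inductive LeavittRel (R : Type u) [Ring R] : LeavittFree R V E → LeavittFree R V E → Prop
  | vert_self (t : R) (a : V) : LeavittRel R (single (vert a * vert a) t) (single (vert a) t)
  | vert_ne (t : R) (a b : V) (h : a ≠ b) : LeavittRel R (single (vert a * vert b) t) 0
  | src_edge (t : R) (e : E) :
      LeavittRel R (single (vert (G.src e) * edge e) t) (single (edge e) t)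
  | edge_rng (t : R) (e : E) :
      LeavittRel R (single (edge e * vert (G.rng e)) t) (single (edge e) t)
  | rng_ghost (t : R) (e : E) :
      LeavittRel R (single (vert (G.rng e) * ghost e) t) (single (ghost e) t)
  | ghost_src (t : R) (e : E) :
      LeavittRel R (single (ghost e * vert (G.src e)) t) (single (ghost e) t)
  | ghost_edge_self (t : R) (e : E) :
      LeavittRel R (single (ghost e * edge e) t) (single (vert (G.rng e)) t)
  | ghost_edge_ne (t : R) (e f : E) (h : e ≠ f) : LeavittRel R (single (ghost e * edge f) t) 0
  | sum_edge_ghost (t : R) (a : V) (hfin : {e : E | G.src e = a}.Finite)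
      (hne : {e : E | G.src e = a}.Nonempty) :
      LeavittRel R (∑ e ∈ hfin.toFinset, single (edge e * ghost e) t) (single (vert a) t)

end DirectedGraph

/-- The Leavitt path algebra `L_R(E)` of a directed graph with coefficients in `R`: the quotient of
the free (non-unital) `R`-algebra on the symbols by the defining relations. -/
def LeavittPathAlgebra (R : Type u) [Ring R] {V : Type v} {E : Type w} (G : DirectedGraph V E) :
    Type (max u v w) :=
  (ringConGen (G.LeavittRel R)).Quotient

namespace LeavittPathAlgebra

open LeavittFree MonoidAlgebra

variable (R : Type u) [Ring R] {V : Type v} {E : Type w} (G : DirectedGraph V E)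

noncomputable instance : NonUnitalRing (LeavittPathAlgebra R G) :=
  inferInstanceAs (NonUnitalRing (ringConGen (G.LeavittRel R)).Quotient)

/-- The class in `L_R(E)` of an element of the free algebra. -/
noncomputable def mk : LeavittFree R V E →ₙ+* LeavittPathAlgebra R G where
  toFun x := RingCon.toQuotient x
  map_mul' _ _ := rfl
  map_zero' := rfl
  map_add' _ _ := rfl

/-- The word of the real path with source `a` and edges `l`: `a` if `l = []`, and
`f₁ ⋯ fₙ r(fₙ)` (which equals `f₁ ⋯ fₙ` in `L_R(E)`) if `l = [f₁, …, fₙ]` with `n ≥ 1`. -/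
def realWord : V → List E → FreeSemigroup (LeavittGen V E)
  | a, [] => vert a
  | _, e :: l => edge e * realWord (G.rng e) l

/-- The word of the ghost path of the path with source `a` and edges `l`: `a` if `l = []`, and
`r(fₙ) fₙ* ⋯ f₁*` (which equals `fₙ* ⋯ f₁*` in `L_R(E)`) if `l = [f₁, …, fₙ]` with `n ≥ 1`. -/
def ghostWord : V → List E → FreeSemigroup (LeavittGen V E)
  | a, [] => vert a
  | _, e :: l => ghostWord (G.rng e) l * ghost e

/-- The element `t α β*` of `L_R(E)`, where `t ∈ R`, `α` is the path with source `a` and edges `l`,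
and `β` is the path with source `b` and edges `m`. -/
noncomputable def monomial (t : R) (a : V) (l : List E) (b : V) (m : List E) : LeavittPathAlgebra R G :=
  mk R G (single (realWord G a l * ghostWord G b m) t)

/-- The elements `t α β*` with `t ∈ R`, `α, β` paths with `r(α) = r(β)` and
`len(α) - len(β) = n`. -/
def monomialsOfDegree (n : ℤ) : Set (LeavittPathAlgebra R G) :=
  {x | ∃ (t : R) (a : V) (l : List E) (b : V) (m : List E) (c : V),
    G.IsPath a l c ∧ G.IsPath b m c ∧ (l.length : ℤ) - m.length = n ∧ x = monomial R G t a l b m}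

/-- The homogeneous component `(L_R(E))_n` of the canonical `ℤ`-grading: the finite sums of elements
`t α β*` with `len(α) - len(β) = n`. -/
noncomputable def homogeneousComponent (n : ℤ) : AddSubgroup (LeavittPathAlgebra R G) :=
  AddSubgroup.closure (monomialsOfDegree R G n)

/-! Facts needed for the ring structure of the component of degree zero. -/

variable {R G}

theorem mk_eq_of_rel {x y : LeavittFree R V E} (h : G.LeavittRel R x y) : mk R G x = mk R G y :=
  (RingCon.eq _).2 (RingConGen.Rel.of _ _ h)

theorem mk_single_mul (t s : R) (x y : FreeSemigroup (LeavittGen V E)) :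
    mk R G (single (x * y) (t * s)) = mk R G (single x t) * mk R G (single y s) := by
  rw [← map_mul, single_mul_single]

theorem vert_mul_realWord (t : R) {a c : V} {l : List E} (h : G.IsPath a l c) :
    mk R G (single (vert a * realWord G a l) t) = mk R G (single (realWord G a l) t) := by
  cases l with
  | nil => exact mk_eq_of_rel (.vert_self t a)
  | cons e l =>
    obtain ⟨rfl, -⟩ := h
    have h1 := mk_single_mul (G := G) t 1 (vert (G.src e) * edge e) (realWord G (G.rng e) l)
    have h2 := mk_single_mul (G := G) t 1 (edge e) (realWord G (G.rng e) l)
    rw [mk_eq_of_rel (.src_edge t e), ← h2] at h1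
    simpa [realWord, mul_assoc] using h1

theorem vert_mul_realWord_ne (t : R) {a b c : V} {l : List E} (h : G.IsPath a l c) (hb : b ≠ a) :
    mk R G (single (vert b * realWord G a l) t) = 0 := by
  have h1 := mk_single_mul (R := R) (G := G) 1 t (vert b) (realWord G a l)
  have h2 := mk_single_mul (R := R) (G := G) 1 t (vert a) (realWord G a l)
  rw [one_mul, vert_mul_realWord t h] at h2
  rw [h2, ← mul_assoc, ← mk_single_mul, mk_eq_of_rel (.vert_ne _ b a hb)] at h1
  simpa using h1

theorem ghostWord_mul_vert (t : R) {a c : V} {l : List E} (h : G.IsPath a l c) :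
    mk R G (single (ghostWord G a l * vert a) t) = mk R G (single (ghostWord G a l) t) := by
  cases l with
  | nil => exact mk_eq_of_rel (.vert_self t a)
  | cons e l =>
    obtain ⟨rfl, -⟩ := h
    have h1 := mk_single_mul (G := G) t 1 (ghostWord G (G.rng e) l) (ghost e * vert (G.src e))
    have h2 := mk_single_mul (G := G) t 1 (ghostWord G (G.rng e) l) (ghost e)
    rw [mk_eq_of_rel (.ghost_src 1 e), ← h2] at h1
    simpa [ghostWord, mul_assoc] using h1

theorem ghostWord_mul_vert_ne (t : R) {a b c : V} {l : List E} (h : G.IsPath a l c) (hb : a ≠ b) :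
    mk R G (single (ghostWord G a l * vert b) t) = 0 := by
  have h1 := mk_single_mul (R := R) (G := G) t 1 (ghostWord G a l) (vert b)
  have h2 := mk_single_mul (R := R) (G := G) t 1 (ghostWord G a l) (vert a)
  rw [mul_one, ghostWord_mul_vert t h] at h2
  rw [h2, mul_assoc, ← mk_single_mul, mk_eq_of_rel (.vert_ne _ a b hb)] at h1
  simpa using h1

theorem isPath_append {a b c : V} {l m : List E} (h : G.IsPath a l b) (h' : G.IsPath b m c) :
    G.IsPath a (l ++ m) c := by
  induction l generalizing a with
  | nil => cases h; exact h'
  | cons e l ih => exact ⟨h.1, ih h.2⟩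

theorem realWord_mul_realWord (t : R) {a b c : V} {l m : List E} (h : G.IsPath a l b)
    (h' : G.IsPath b m c) :
    mk R G (single (realWord G a l * realWord G b m) t) =
      mk R G (single (realWord G a (l ++ m)) t) := by
  induction l generalizing a t with
  | nil => cases h; exact vert_mul_realWord t h'
  | cons e l ih =>
    have h1 := mk_single_mul (G := G) t 1 (edge e) (realWord G (G.rng e) l * realWord G b m)
    rw [ih 1 h.2, ← mk_single_mul] at h1
    simpa [realWord, mul_assoc] using h1

theorem ghostWord_mul_ghostWord (t : R) {a b c : V} {l m : List E} (h : G.IsPath a l b)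
    (h' : G.IsPath b m c) :
    mk R G (single (ghostWord G b m * ghostWord G a l) t) =
      mk R G (single (ghostWord G a (l ++ m)) t) := by
  induction l generalizing a t with
  | nil => cases h; exact ghostWord_mul_vert t h'
  | cons e l ih =>
    have h1 := mk_single_mul (G := G) t 1 (ghostWord G b m * ghostWord G (G.rng e) l) (ghost e)
    rw [ih t h.2, ← mk_single_mul] at h1
    simpa [ghostWord, mul_assoc] using h1

theorem ghostWord_mul_realWord (t : R) {a b c d : V} {l m : List E} (h : G.IsPath a l c)
    (h' : G.IsPath b m d) :
    mk R G (single (ghostWord G a l * realWord G b m) t) = 0 ∨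
    (∃ m', G.IsPath c m' d ∧ m.length = l.length + m'.length ∧
      mk R G (single (ghostWord G a l * realWord G b m) t) =
        mk R G (single (realWord G c m') t)) ∨
    (∃ l', G.IsPath d l' c ∧ l.length = m.length + l'.length ∧
      mk R G (single (ghostWord G a l * realWord G b m) t) =
        mk R G (single (ghostWord G d l') t)) := by
  induction l generalizing a b m t with
  | nil =>
    obtain rfl : a = c := h
    by_cases hab : a = b
    · subst hab
      exact Or.inr (Or.inl ⟨m, h', by simp, vert_mul_realWord t h'⟩)
    · exact Or.inl (vert_mul_realWord_ne t h' hab)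
  | cons e l ih =>
    cases m with
    | nil =>
      obtain rfl : b = d := h'
      by_cases hab : a = b
      · subst hab
        exact Or.inr (Or.inr ⟨e :: l, h, by simp, ghostWord_mul_vert t h⟩)
      · exact Or.inl (ghostWord_mul_vert_ne t h hab)
    | cons f m =>
      have key : mk R G (single (ghostWord G a (e :: l) * realWord G b (f :: m)) t) =
          mk R G (single (ghostWord G (G.rng e) l) t) * mk R G (single (ghost e * edge f) 1) *
            mk R G (single (realWord G (G.rng f) m) 1) := by
        rw [← mk_single_mul, ← mk_single_mul]
        simp [ghostWord, realWord, mul_assoc]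
      by_cases hef : e = f
      · subst hef
        have key' : mk R G (single (ghostWord G a (e :: l) * realWord G b (e :: m)) t) =
            mk R G (single (ghostWord G (G.rng e) l * realWord G (G.rng e) m) t) := by
          rw [key, mk_eq_of_rel (.ghost_edge_self 1 e), ← mk_single_mul, mul_one,
            ghostWord_mul_vert t h.2, ← mk_single_mul, mul_one]
        rw [key']
        rcases ih t h.2 h'.2 with h0 | ⟨m', h1, h2, h3⟩ | ⟨l', h1, h2, h3⟩
        · exact Or.inl h0
        · exact Or.inr (Or.inl ⟨m', h1, by simp only [List.length_cons]; omega, h3⟩)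
        · exact Or.inr (Or.inr ⟨l', h1, by simp only [List.length_cons]; omega, h3⟩)
      · rw [key, mk_eq_of_rel (.ghost_edge_ne 1 e f hef)]
        exact Or.inl (by simp)

theorem monomial_mul_monomial_mem {x y : LeavittPathAlgebra R G}
    (hx : x ∈ monomialsOfDegree R G 0) (hy : y ∈ monomialsOfDegree R G 0) :
    x * y ∈ homogeneousComponent R G 0 := by
  obtain ⟨t, a, l, b, m, c, hl, hm, hlen, rfl⟩ := hx
  obtain ⟨s, a', l', b', m', c', hl', hm', hlen', rfl⟩ := hy
  have key : monomial R G t a l b m * monomial R G s a' l' b' m' =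
      mk R G (single (realWord G a l) t) *
        mk R G (single (ghostWord G b m * realWord G a' l') 1) *
          mk R G (single (ghostWord G b' m') s) := by
    unfold monomial
    rw [← mk_single_mul, ← mk_single_mul, ← mk_single_mul]
    simp [mul_assoc]
  rw [key]
  rcases ghostWord_mul_realWord (1 : R) hm hl' with h0 | ⟨p, h1, h2, h3⟩ | ⟨p, h1, h2, h3⟩
  · rw [h0]
    simp
  · rw [h3, ← mk_single_mul, realWord_mul_realWord _ hl h1, ← mk_single_mul, mul_one]
    refine AddSubgroup.subset_closure ⟨_, _, _, _, _, _, isPath_append hl h1, hm', ?_, rfl⟩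
    simp only [List.length_append]
    push_cast
    omega
  · rw [h3, mul_assoc, ← mk_single_mul, ghostWord_mul_ghostWord _ hm' h1, ← mk_single_mul, one_mul]
    refine AddSubgroup.subset_closure ⟨_, _, _, _, _, _, hl, isPath_append hm' h1, ?_, rfl⟩
    simp only [List.length_append]
    push_cast
    omega

variable (R G)

/-- The principal component `(L_R(E))_0` of the canonical `ℤ`-grading, as a subring (without a
specified identity) of `L_R(E)`. -/
noncomputable def principalComponent : NonUnitalSubring (LeavittPathAlgebra R G) where
  carrier := homogeneousComponent R G 0
  add_mem' := (homogeneousComponent R G 0).add_mem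
  zero_mem' := (homogeneousComponent R G 0).zero_mem
  neg_mem' := (homogeneousComponent R G 0).neg_mem
  mul_mem' {x y} hx hy := by
    induction hx, hy using AddSubgroup.closure_induction₂ with
    | mem x y hx hy => exact monomial_mul_monomial_mem hx hy
    | zero_left y hy => simp
    | zero_right x hx => simp
    | add_left x y z hx hy hz h1 h2 => simpa [add_mul] using AddSubgroup.add_mem _ h1 h2
    | add_right x y z hx hy hz h1 h2 => simpa [mul_add] using AddSubgroup.add_mem _ h1 h2
    | neg_left x y hx hy h => simpa using AddSubgroup.neg_mem _ h
    | neg_right x y hx hy h => simpa using AddSubgroup.neg_mem _ h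

variable {R G}

theorem vert_mem (a : V) : mk R G (single (vert a) 1) ∈ homogeneousComponent R G 0 :=
  AddSubgroup.subset_closure
    ⟨1, a, [], a, [], a, rfl, rfl, by simp, (mk_eq_of_rel (.vert_self 1 a)).symm⟩

variable (R G)

/-- The sum of all vertices of a graph with finitely many vertices. -/
noncomputable def sumVert [Finite V] : LeavittPathAlgebra R G :=
  letI := Fintype.ofFinite V
  ∑ a : V, mk R G (single (vert a) 1)

variable {R G}

theorem sumVert_mul [Finite V] {x : LeavittPathAlgebra R G}
    (hx : x ∈ homogeneousComponent R G 0) : sumVert R G * x = x := by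
  induction hx using AddSubgroup.closure_induction with
  | mem x hx =>
    obtain ⟨t, a, l, b, m, c, hl, hm, hlen, rfl⟩ := hx
    have h1 : monomial R G t a l b m =
        mk R G (single (realWord G a l) t) * mk R G (single (ghostWord G b m) 1) := by
      rw [← mk_single_mul, mul_one]; rfl
    rw [h1, ← mul_assoc]
    congr 1
    unfold sumVert
    rw [Finset.sum_mul, Finset.sum_eq_single a, ← mk_single_mul, one_mul, vert_mul_realWord t hl]
    · intro d _ hd
      rw [← mk_single_mul, vert_mul_realWord_ne _ hl hd]
    · simp
  | zero => simp
  | add x y _ _ h1 h2 => rw [mul_add, h1, h2]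
  | neg x _ h => rw [mul_neg, h]

theorem mul_sumVert [Finite V] {x : LeavittPathAlgebra R G}
    (hx : x ∈ homogeneousComponent R G 0) : x * sumVert R G = x := by
  induction hx using AddSubgroup.closure_induction with
  | mem x hx =>
    obtain ⟨t, a, l, b, m, c, hl, hm, hlen, rfl⟩ := hx
    have h1 : monomial R G t a l b m =
        mk R G (single (realWord G a l) t) * mk R G (single (ghostWord G b m) 1) := by
      rw [← mk_single_mul, mul_one]; rfl
    rw [h1, mul_assoc]
    congr 1
    unfold sumVert
    rw [Finset.mul_sum, Finset.sum_eq_single b, ← mk_single_mul, one_mul, ghostWord_mul_vert 1 hm]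
    · intro d _ hd
      rw [← mk_single_mul, ghostWord_mul_vert_ne _ hm hd.symm]
    · simp
  | zero => simp
  | add x y _ _ h1 h2 => rw [add_mul, h1, h2]
  | neg x _ h => rw [neg_mul, h]

/-- For a graph with finitely many vertices `(L_R(E))_0` is a ring with identity, the sum of the
vertices. -/
noncomputable instance [Finite V] : Ring (principalComponent R G) where
  __ := (inferInstance : NonUnitalRing (principalComponent R G))
  one := ⟨sumVert R G, by
    unfold sumVert
    exact AddSubgroup.sum_mem _ fun a _ => vert_mem a⟩
  one_mul x := Subtype.ext (sumVert_mul x.2)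
  mul_one x := Subtype.ext (mul_sumVert x.2)

end LeavittPathAlgebra

/-- A ring is von Neumann regular if every `a` equals `a b a` for some `b`. -/
def IsVonNeumannRegularRing (A : Type u) [Ring A] : Prop :=
  ∀ a : A, ∃ b : A, a = a * b * a

/-! The ring $(L_R(E))_0$ is a finite non-empty product of matrix rings over $R$; everything claimed
follows from that isomorphism.

Fix $N > |E^0|$. Relation (d) rewrites $t\,\alpha\beta^*$, when $\alpha$ and $\beta$ are shorter
than $N$ and do not end in a sink, as a sum of such elements one edge longer. Elements longer than
$N$ can be shortened, and here Condition (NE) enters. A path with more than $|E^0|$ edges ends on a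
closed path, since otherwise it would repeat a vertex and all later vertices would lie on closed
paths. A vertex on a closed path emits exactly one edge, and on the finite set of such vertices the
successor map is a permutation. Hence the last edges of $\alpha$ and $\beta$ coincide, and (d),
whose sum has a single term there, cancels them. So the degree zero part is spanned by the
$t\,\alpha\beta^*$ of length exactly $N$, or of smaller length and ending in a sink
(`homogeneousComponent_zero_le`).

Grouped by length and common range, these elements multiply as matrix units: $\beta^*\alpha'$
vanishes for distinct paths of equal length, and for unequal lengths because the shorter path ends
in a sink and cannot be continued. Their independence reduces to $tv \neq 0$ for $t \neq 0$
(`eq_zero_of_mk_single_vert_eq_zero`), which is read off from a representation on functions $E^0 \to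
\mathbb{N} \to R$. `RingEquiv.nonempty_pi_matrix` then gives the isomorphism.

One diagonal matrix unit from each of the $k$ blocks adds up to a full idempotent with corner $R^k$,
whence the Morita equivalence. The ring-theoretic properties pass between $R$ and the product by
arguments on matrix rings and quotients; right-handed versions use opposite rings. -/

open CategoryTheory in
/-- An additive functor is linear for any `ℤ`-linear structures. -/
theorem CategoryTheory.Functor.linear_int {C D : Type*} [Category* C] [Category* D]
    [Preadditive C] [Preadditive D] (lC : CategoryTheory.Linear ℤ C) (lD : CategoryTheory.Linear ℤ D)
    (F : C ⥤ D) [F.Additive] :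
    @Functor.Linear ℤ _ C D _ _ _ _ lC lD F :=
  @Functor.Linear.mk _ _ _ _ _ _ _ _ lC lD _ fun {X Y} f r =>
    -- An abelian group has only one $\mathbb{Z}$-module structure, so each given action is the
    -- canonical one, which additive maps respect.
    have h1 : (lC.homModule X Y).toSMul.smul r f =
        (AddCommGroup.toIntModule (X ⟶ Y)).toSMul.smul r f :=
      int_smul_eq_zsmul (lC.homModule X Y) r f
    have h2 : (lD.homModule (F.obj X) (F.obj Y)).toSMul.smul r (F.map f) =
        (AddCommGroup.toIntModule (F.obj X ⟶ F.obj Y)).toSMul.smul r (F.map f) :=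
      int_smul_eq_zsmul (lD.homModule (F.obj X) (F.obj Y)) r (F.map f)
    (congrArg F.map h1).trans (F.map_zsmul.trans h2.symm)

/-! ### Morita equivalence from a full idempotent -/

/-- Data exhibiting the ring `B` as a full corner `e A e` of the ring `A`, where `e = incl 1`. -/
structure FullCorner (A : Type u) (B : Type v) [Ring A] [Ring B] where
  /-- the inclusion of the corner -/
  incl : B →ₙ+* A
  incl_injective : Function.Injective incl
  /-- the compression `a ↦ e a e` -/
  compr : A → B
  incl_compr (a : A) : incl (compr a) = incl 1 * a * incl 1
  /-- the number of terms in the decomposition of the identity -/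
  n : ℕ
  /-- left factors -/
  x : Fin n → A
  /-- right factors -/
  y : Fin n → A
  sum_eq_one : ∑ j, x j * incl 1 * y j = 1

namespace FullCorner

variable {A : Type u} {B : Type v} [Ring A] [Ring B] (F : FullCorner A B)

theorem incl_one_mul (b : B) : F.incl 1 * F.incl b = F.incl b := by rw [← map_mul, one_mul]

theorem incl_mul_one (b : B) : F.incl b * F.incl 1 = F.incl b := by rw [← map_mul, mul_one]

theorem compr_add (a a' : A) : F.compr (a + a') = F.compr a + F.compr a' :=
  F.incl_injective <| by simp only [map_add, incl_compr, mul_add, add_mul]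

theorem compr_zero : F.compr 0 = 0 :=
  F.incl_injective <| by simp [incl_compr]

theorem sum_mul_mul (a a' : A) : ∑ j, (a * F.x j * F.incl 1) * (F.y j * a') = a * a' := by
  calc _ = a * (∑ j, F.x j * F.incl 1 * F.y j) * a' := by
        rw [Finset.mul_sum, Finset.sum_mul]; simp only [mul_assoc]
    _ = _ := by rw [F.sum_eq_one, mul_one]

/-- Inserting $1 = \sum_j x_j e y_j$ between the factors turns multiplication in $A$ into matrix
multiplication over the corner. The induced modules rest on this identity. -/
theorem sum_compr_mul (a a' : A) :
    ∑ j, F.compr (a * F.x j) * F.compr (F.y j * a') = F.compr (a * a') := by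
  apply F.incl_injective
  have h := congrArg (fun z => F.incl 1 * z * F.incl 1) (F.sum_mul_mul a a')
  simp only [Finset.mul_sum, Finset.sum_mul] at h
  rw [map_sum, F.incl_compr, ← h]
  refine Finset.sum_congr rfl fun j _ => ?_
  rw [map_mul, F.incl_compr, F.incl_compr]
  have h1 : F.incl 1 * F.incl 1 = F.incl 1 := F.incl_one_mul 1
  calc _ = F.incl 1 * (a * F.x j) * (F.incl 1 * F.incl 1) * (F.y j * a') * F.incl 1 := by
        noncomm_ring
    _ = _ := by rw [h1]; noncomm_ring

/-- The corner `e N` of an `A`-module `N`. -/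
def cornerAddSubgroup (N : Type w) [AddCommGroup N] [Module A N] : AddSubgroup N where
  carrier := {m | F.incl 1 • m = m}
  add_mem' {a b} ha hb := by
    simp only [Set.mem_ofPred_eq, smul_add] at *
    rw [ha, hb]
  zero_mem' := smul_zero _
  neg_mem' {a} ha := by
    simp only [Set.mem_ofPred_eq, smul_neg] at *
    rw [ha]

/-- The corner `e N` of an `A`-module `N`, as a type. -/
def CornerModule (N : Type w) [AddCommGroup N] [Module A N] : Type w := F.cornerAddSubgroup N

/-! ### Corners of modules and of linear maps -/

section

variable (N : Type w) [AddCommGroup N] [Module A N]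

noncomputable instance : AddCommGroup (F.CornerModule N) :=
  inferInstanceAs (AddCommGroup (F.cornerAddSubgroup N))

noncomputable instance : Module B (F.CornerModule N) where
  smul b m := ⟨F.incl b • m.1, by
    change F.incl 1 • F.incl b • m.1 = _
    rw [← mul_smul, incl_one_mul]⟩
  one_smul m := Subtype.ext m.2
  mul_smul b b' m := Subtype.ext <| by
    change F.incl (b * b') • m.1 = F.incl b • F.incl b' • m.1
    rw [map_mul, mul_smul]
  smul_zero b := Subtype.ext (smul_zero (F.incl b))
  smul_add b m m' := Subtype.ext (smul_add (F.incl b) m.1 m'.1)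
  add_smul b b' m := Subtype.ext <| by
    change F.incl (b + b') • m.1 = F.incl b • m.1 + F.incl b' • m.1
    rw [map_add, add_smul]
  zero_smul m := Subtype.ext <| by
    change F.incl 0 • m.1 = 0
    rw [map_zero, zero_smul]

variable {N}

theorem CornerModule.coe_smul (b : B) (m : F.CornerModule N) :
    (b • m).1 = F.incl b • m.1 := rfl

theorem CornerModule.coe_sum {ι : Type*} (s : Finset ι) (m : ι → F.CornerModule N) :
    (∑ j ∈ s, m j).1 = ∑ j ∈ s, (m j).1 := map_sum (F.cornerAddSubgroup N).subtype m s

theorem CornerModule.coe_add (m m' : F.CornerModule N) : (m + m').1 = m.1 + m'.1 := rfl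

/-- The projection `N → e N`. -/
noncomputable def proj : N →+ F.CornerModule N where
  toFun m := ⟨F.incl 1 • m, by
    change F.incl 1 • F.incl 1 • m = _
    rw [← mul_smul, incl_one_mul]⟩
  map_zero' := Subtype.ext (smul_zero _)
  map_add' m m' := Subtype.ext (smul_add _ m m')

theorem sum_smul_proj (m : N) : ∑ j, F.x j • (F.proj (F.y j • m)).1 = m := by
  calc _ = (∑ j, F.x j * F.incl 1 * F.y j) • m := by
        rw [Finset.sum_smul]; simp only [mul_smul]; rfl
    _ = m := by rw [F.sum_eq_one, one_smul]

/-- The elements $e y_k m$ serve as coordinates of $m$ in the corner, and $A$ acts on them through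
coefficients in $B$. This is what makes `extendCorner` $A$-linear. -/
theorem proj_smul (a : A) (m : N) :
    F.proj (a • m) = ∑ k, F.compr (a * F.x k) • F.proj (F.y k • m) := by
  apply Subtype.ext
  rw [CornerModule.coe_sum]
  have h := F.sum_mul_mul a 1
  simp only [mul_one] at h
  change F.incl 1 • a • m = ∑ k, F.incl (F.compr (a * F.x k)) • F.incl 1 • F.y k • m
  simp only [← mul_smul, incl_compr, ← Finset.sum_smul]
  congr 1
  conv_lhs => rw [← h]
  rw [Finset.mul_sum]
  have h1 : F.incl 1 * F.incl 1 = F.incl 1 := F.incl_one_mul 1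
  refine Finset.sum_congr rfl fun j _ => ?_
  calc _ = F.incl 1 * (a * F.x j) * (F.incl 1) * (F.y j) := by noncomm_ring
    _ = F.incl 1 * (a * F.x j) * (F.incl 1 * F.incl 1) * (F.y j) := by rw [h1]
    _ = _ := by noncomm_ring

variable {N' : Type w} [AddCommGroup N'] [Module A N']

/-- The restriction of an `A`-linear map to corners. -/
noncomputable def mapCorner (f : N →ₗ[A] N') : F.CornerModule N →ₗ[B] F.CornerModule N' where
  toFun m := ⟨f m.1, by
    change F.incl 1 • f m.1 = f m.1
    rw [← map_smul]
    exact congrArg f m.2⟩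
  map_add' m m' := Subtype.ext (map_add f m.1 m'.1)
  map_smul' b m := Subtype.ext (map_smul f (F.incl b) m.1)

/-- The corner generates $N$ over $A$, by `sum_smul_proj`. -/
theorem mapCorner_injective :
    Function.Injective (F.mapCorner : (N →ₗ[A] N') → _) := by
  intro f f' h
  ext m
  rw [← F.sum_smul_proj m, map_sum, map_sum]
  refine Finset.sum_congr rfl fun j _ => ?_
  rw [map_smul f, map_smul f']
  exact congrArg (F.x j • ·) (congrArg Subtype.val (LinearMap.congr_fun h _))

/-- The extension of a linear map between corners. -/
noncomputable def extendCorner (g : F.CornerModule N →ₗ[B] F.CornerModule N') : N →ₗ[A] N' where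
  toFun m := ∑ j, F.x j • (g (F.proj (F.y j • m))).1
  map_add' m m' := by
    simp only [smul_add, map_add, CornerModule.coe_add, Finset.sum_add_distrib]
  map_smul' a m := by
    have key : ∀ j, F.x j • (g (F.proj (F.y j • a • m))).1 =
        ∑ k, (F.x j * F.incl 1 * (F.y j * (a * F.x k * F.incl 1))) •
          (g (F.proj (F.y k • m))).1 := by
      intro j
      rw [← mul_smul (F.y j), F.proj_smul, map_sum]
      rw [CornerModule.coe_sum, Finset.smul_sum]
      refine Finset.sum_congr rfl fun k _ => ?_
      rw [map_smul, CornerModule.coe_smul, ← mul_smul, incl_compr]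
      congr 1
      noncomm_ring
    simp only [key, RingHom.id_apply]
    rw [Finset.sum_comm, Finset.smul_sum]
    refine Finset.sum_congr rfl fun k _ => ?_
    -- The sum over $j$ collapses because $\sum_j x_j e y_j = 1$; the remaining $e$ is absorbed
    -- since values of $g$ lie in the corner.
    have h := F.sum_mul_mul 1 (a * F.x k * F.incl 1)
    simp only [one_mul] at h
    rw [← Finset.sum_smul, h, mul_smul, mul_smul, ← mul_smul (F.x k)]
    congr 1
    rw [mul_smul]
    exact congrArg (F.x k • ·) (g (F.proj (F.y k • m))).2

theorem mapCorner_extendCorner (g : F.CornerModule N →ₗ[B] F.CornerModule N') :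
    F.mapCorner (F.extendCorner g) = g := by
  ext m
  apply Subtype.ext
  change ∑ j, F.x j • (g (F.proj (F.y j • m.1))).1 = (g m).1
  have h2 := (g m).2
  change F.incl 1 • (g m).1 = (g m).1 at h2
  have h3 : ∀ j, F.proj (F.y j • m.1) = F.compr (F.y j) • m := by
    intro j
    apply Subtype.ext
    change F.incl 1 • F.y j • m.1 = F.incl (F.compr (F.y j)) • m.1
    rw [incl_compr]
    conv_lhs => rw [← show F.incl 1 • m.1 = m.1 from m.2]
    simp only [mul_smul]
  calc _ = ∑ j, F.x j • F.incl 1 • F.y j • (g m).1 := by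
        refine Finset.sum_congr rfl fun j _ => ?_
        rw [h3, map_smul, CornerModule.coe_smul, incl_compr, mul_smul, h2, mul_smul]
    _ = _ := F.sum_smul_proj _

end

/-! ### Modules induced from the corner -/

section

variable (M : Type w) [AddCommGroup M] [Module B M]

/-- The `A`-action on `Mⁿ` (not unital) used to induce modules. -/
noncomputable def act (a : A) : (Fin F.n → M) →+ (Fin F.n → M) where
  toFun m j := ∑ k, F.compr (F.y j * a * F.x k) • m k
  map_zero' := by ext; simp
  map_add' m m' := by ext; simp [Finset.sum_add_distrib]

theorem act_apply (a : A) (m : Fin F.n → M) (j : Fin F.n) :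
    F.act M a m j = ∑ k, F.compr (F.y j * a * F.x k) • m k := rfl

/-- The matrices $(e y_j a x_k e)_{j,k}$ depend multiplicatively on $a$. In particular the matrix of
$1$ is idempotent; its fixed points in $M^n$ are a concrete model of $Ae \otimes_B M$. -/
theorem act_mul (a a' : A) (m : Fin F.n → M) :
    F.act M (a * a') m = F.act M a (F.act M a' m) := by
  ext j
  simp only [act_apply, Finset.smul_sum]
  rw [Finset.sum_comm]
  refine Finset.sum_congr rfl fun l _ => ?_
  simp only [← mul_smul, ← Finset.sum_smul]
  congr 1
  have h := F.sum_compr_mul (F.y j * a) (a' * F.x l)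
  simp only [mul_assoc] at h ⊢
  exact h.symm

/-- The `A`-module induced from a `B`-module, as a subgroup of `Mⁿ`. -/
def inducedAddSubgroup : AddSubgroup (Fin F.n → M) where
  carrier := {m | F.act M 1 m = m}
  add_mem' {a b} ha hb := by
    simp only [Set.mem_ofPred_eq, map_add] at *
    rw [ha, hb]
  zero_mem' := map_zero _
  neg_mem' {a} ha := by
    simp only [Set.mem_ofPred_eq, map_neg] at *
    rw [ha]

/-- The `A`-module induced from a `B`-module. -/
def InducedModule : Type w := F.inducedAddSubgroup M

noncomputable instance : AddCommGroup (F.InducedModule M) :=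
  inferInstanceAs (AddCommGroup (F.inducedAddSubgroup M))

noncomputable instance : Module A (F.InducedModule M) where
  smul a m := ⟨F.act M a m.1, by
    change F.act M 1 (F.act M a m.1) = _
    rw [← act_mul, one_mul]⟩
  one_smul m := Subtype.ext m.2
  mul_smul b b' m := Subtype.ext (F.act_mul M b b' m.1)
  smul_zero b := Subtype.ext (map_zero (F.act M b))
  smul_add b m m' := Subtype.ext (map_add (F.act M b) m.1 m'.1)
  add_smul b b' m := Subtype.ext <| by
    change F.act M (b + b') m.1 = F.act M b m.1 + F.act M b' m.1
    ext j
    simp [act_apply, mul_add, add_mul, compr_add, add_smul, Finset.sum_add_distrib]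
  zero_smul m := Subtype.ext <| by
    change F.act M 0 m.1 = 0
    ext j
    simp [act_apply, compr_zero]

theorem act_column (a : A) (m : M) :
    F.act M a (fun k => F.compr (F.y k) • m) = fun j => F.compr (F.y j * a) • m := by
  ext j
  have h := F.sum_compr_mul (F.y j * a) 1
  simp only [mul_one] at h
  simp only [act_apply, ← mul_smul, ← Finset.sum_smul, h]

theorem row_act (a : A) (m : Fin F.n → M) :
    ∑ j, F.compr (F.x j) • F.act M a m j = ∑ k, F.compr (a * F.x k) • m k := by
  simp only [act_apply, Finset.smul_sum]
  rw [Finset.sum_comm]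
  refine Finset.sum_congr rfl fun l _ => ?_
  have h := F.sum_compr_mul 1 (a * F.x l)
  simp only [one_mul, ← mul_assoc] at h
  simp only [← mul_smul, ← Finset.sum_smul, h]

theorem compr_mul_incl (a : A) (b : B) : F.compr (a * F.incl b) = F.compr a * b :=
  F.incl_injective <| by
    rw [map_mul, incl_compr, incl_compr, mul_assoc, mul_assoc, incl_mul_one, mul_assoc, mul_assoc,
      incl_one_mul]

theorem compr_incl_mul (a : A) (b : B) : F.compr (F.incl b * a) = b * F.compr a :=
  F.incl_injective <| by
    rw [map_mul, incl_compr, incl_compr, ← mul_assoc, ← mul_assoc, ← mul_assoc, incl_one_mul,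
      incl_mul_one]

/-- The corner of the induced module is the original module. -/
noncomputable def cornerInducedEquiv : F.CornerModule (F.InducedModule M) ≃ₗ[B] M where
  toFun m := ∑ j, F.compr (F.x j) • m.1.1 j
  map_add' m m' := by
    change ∑ j, F.compr (F.x j) • (m.1.1 j + m'.1.1 j) = _
    simp [Finset.sum_add_distrib]
  map_smul' b m := by
    change ∑ j, F.compr (F.x j) • F.act M (F.incl b) m.1.1 j = _
    rw [row_act, RingHom.id_apply, Finset.smul_sum]
    simp only [compr_incl_mul, mul_smul]
  invFun m := ⟨⟨fun j => F.compr (F.y j) • m, by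
      change F.act M 1 _ = _
      rw [act_column]; simp only [mul_one]⟩, Subtype.ext <| by
      change F.act M (F.incl 1) _ = _
      rw [act_column]; simp only [compr_mul_incl, mul_one]⟩
  left_inv m := by
    apply Subtype.ext
    apply Subtype.ext
    have h : F.act M (F.incl 1) m.1.1 = m.1.1 := congrArg Subtype.val m.2
    change (fun j => F.compr (F.y j) • ∑ j, F.compr (F.x j) • m.1.1 j) = m.1.1
    conv_rhs => rw [← h]
    ext j
    rw [act_apply, Finset.smul_sum]
    refine Finset.sum_congr rfl fun k _ => ?_
    rw [← mul_smul]
    congr 1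
    apply F.incl_injective
    -- Both sides reduce to $e y_j e x_k e$ once repeated factors $e$ are merged.
    have h1 (z : A) : F.incl 1 * (F.incl 1 * z) = F.incl 1 * z := by
      rw [← mul_assoc, F.incl_one_mul]
    rw [map_mul]
    simp only [incl_compr, mul_assoc, h1]
  right_inv m := by
    have h := F.sum_compr_mul 1 1
    simp only [one_mul, mul_one] at h
    have h1 : F.compr 1 = 1 := F.incl_injective <| by rw [incl_compr, mul_one, incl_one_mul]
    change ∑ j, F.compr (F.x j) • F.compr (F.y j) • m = m
    simp only [← mul_smul, ← Finset.sum_smul, h, h1, one_smul]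

end

/-! ### The equivalence of module categories -/

open CategoryTheory

/-- The functor `N ↦ e N` from `A`-modules to `B`-modules. -/
noncomputable def cornerFunctor : ModuleCat.{max u v} A ⥤ ModuleCat.{max u v} B where
  obj N := ModuleCat.of B (F.CornerModule N)
  map f := ModuleCat.ofHom (F.mapCorner f.hom)
  map_id _ := rfl
  map_comp _ _ := rfl

instance : F.cornerFunctor.Faithful where
  map_injective {N N'} f f' h :=
    ModuleCat.hom_ext <| F.mapCorner_injective <| by
      exact congrArg ModuleCat.Hom.hom h

instance : F.cornerFunctor.Full where
  map_surjective g :=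
    ⟨ModuleCat.ofHom (F.extendCorner g.hom), ModuleCat.hom_ext (F.mapCorner_extendCorner g.hom)⟩

instance : F.cornerFunctor.EssSurj where
  mem_essImage M :=
    ⟨ModuleCat.of A (F.InducedModule M), ⟨(F.cornerInducedEquiv M).toModuleIso⟩⟩

instance : F.cornerFunctor.IsEquivalence where

theorem isMoritaEquivalent {A : Type u} {B : Type v} [Ring A] [Ring B] (F : FullCorner A B) :
    IsMoritaEquivalent ℤ A B where
  cond := ⟨{
    eqv := F.cornerFunctor.asEquivalence
    linear :=
      have : F.cornerFunctor.Additive := ⟨rfl⟩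
      Functor.linear_int _ _ F.cornerFunctor }⟩

end FullCorner

/-! ### Ring-theoretic properties of finite products of matrix rings -/

/-! ### Von Neumann regularity of matrix rings -/

section VonNeumannRegular

theorem IsVonNeumannRegularRing.of_surjective {A : Type u} {B : Type v} [Ring A] [Ring B]
    (f : A →+* B) (hf : Function.Surjective f) (h : IsVonNeumannRegularRing A) :
    IsVonNeumannRegularRing B := fun b => by
  obtain ⟨a, rfl⟩ := hf b
  obtain ⟨c, hc⟩ := h a
  exact ⟨f c, by rw [← map_mul, ← map_mul, ← hc]⟩

theorem IsVonNeumannRegularRing.pi {I : Type v} {A : I → Type w} [∀ i, Ring (A i)]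
    (h : ∀ i, IsVonNeumannRegularRing (A i)) : IsVonNeumannRegularRing (∀ i, A i) := fun a => by
  choose b hb using fun i => h i (a i)
  exact ⟨b, funext hb⟩

variable {R : Type u} [Ring R]

/-- If `a - a b a` has an inner inverse, then so does `a`. -/
theorem Matrix.exists_inner_inverse_of_sub {m n : Type*} [Fintype m] [Fintype n] [DecidableEq m]
    [DecidableEq n] {a : Matrix m n R} {b : Matrix n m R}
    (h : ∃ c : Matrix n m R, a - a * b * a = (a - a * b * a) * c * (a - a * b * a)) :
    ∃ c : Matrix n m R, a = a * c * a := by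
  obtain ⟨c, hc⟩ := h
  -- McCoy's lemma: multiplying the second term by $a$ on both sides gives $(a-aba)c(a-aba) = a -
  -- aba$, which makes up for the defect of $b$.
  refine ⟨b + (1 - b * a) * c * (1 - a * b), ?_⟩
  have h1 : a * (1 - b * a) = a - a * b * a := by
    rw [Matrix.mul_sub, Matrix.mul_one, Matrix.mul_assoc]
  have h2 : (1 - a * b) * a = a - a * b * a := by rw [Matrix.sub_mul, Matrix.one_mul]
  have h3 : a * ((1 - b * a) * c * (1 - a * b)) * a =
      (a * (1 - b * a)) * c * ((1 - a * b) * a) := by simp only [Matrix.mul_assoc]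
  rw [Matrix.mul_add, Matrix.add_mul, h3, h1, h2, ← hc, add_sub_cancel]

/-- Entries are cleared one at a time: if $r$ is an inner inverse of the entry $a_k$, then $a - aba$
with $b = r$ in position $k$ vanishes at $k$ and wherever $a$ vanishes. McCoy's lemma lifts the
result back to $a$. -/
theorem IsVonNeumannRegularRing.exists_inner_inverse_column (hR : IsVonNeumannRegularRing R)
    {m : Type v} [Fintype m] [DecidableEq m] (s : Finset m) (a : Matrix m Unit R)
    (ha : ∀ i ∉ s, ∀ j, a i j = 0) : ∃ c : Matrix Unit m R, a = a * c * a := by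
  induction s using Finset.induction_on generalizing a with
  | empty =>
    refine ⟨0, ?_⟩
    ext i j
    simp [ha i (by simp)]
  | insert k s hk ih =>
    obtain ⟨r, hr⟩ := hR (a k ())
    apply Matrix.exists_inner_inverse_of_sub (b := Matrix.single () k r)
    have hab (i : m) (j : Unit) :
        (a * Matrix.single () k r * a) i j = a i () * r * a k () := by
      cases j
      simp [Matrix.mul_apply, Matrix.single_apply]
    apply ih
    intro i hi j
    rw [Matrix.sub_apply, hab]
    cases j
    by_cases hik : i = k
    · subst hik
      rw [← hr, sub_self]
    · simp [ha i (by simp [hik, hi])]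

/-- The same elimination, now by columns: an inner inverse $c$ of column $k$, placed as row $k$ of
$b$, makes column $k$ of $a - aba$ vanish and keeps zero columns zero. -/
theorem IsVonNeumannRegularRing.exists_inner_inverse_of_columns (hR : IsVonNeumannRegularRing R)
    {m : Type v} {n : Type w} [Fintype m] [DecidableEq m] [Fintype n] [DecidableEq n]
    (s : Finset n) (a : Matrix m n R)
    (ha : ∀ j ∉ s, ∀ i, a i j = 0) : ∃ c : Matrix n m R, a = a * c * a := by
  induction s using Finset.induction_on generalizing a with
  | empty =>
    refine ⟨0, ?_⟩
    ext i j
    simp [ha j (by simp)]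
  | insert k s hk ih =>
    obtain ⟨c, hc⟩ := hR.exists_inner_inverse_column Finset.univ
      (Matrix.of fun i (_ : Unit) => a i k) (by simp)
    have hab (i j) : (a * (Matrix.of fun l i => if l = k then c () i else 0) * a) i j =
        ∑ l, a i k * c () l * a l j := by
      simp [Matrix.mul_apply]
    apply Matrix.exists_inner_inverse_of_sub
      (b := Matrix.of fun l i => if l = k then c () i else 0)
    apply ih
    intro j hj i
    rw [Matrix.sub_apply, hab]
    by_cases hjk : j = k
    · subst hjk
      have := congrFun (congrFun hc i) ()
      simp only [Matrix.mul_apply, Matrix.of_apply, Finset.univ_unique, Finset.sum_singleton] at this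
      rw [sub_eq_zero]
      exact this
    · simp [ha j (by simp [hjk, hj])]

theorem IsVonNeumannRegularRing.matrix (hR : IsVonNeumannRegularRing R) (n : Type v) [Fintype n]
    [DecidableEq n] : IsVonNeumannRegularRing (Matrix n n R) := fun a =>
  hR.exists_inner_inverse_of_columns Finset.univ a (by simp)

theorem IsVonNeumannRegularRing.of_matrix {n : Type v} [Fintype n] [DecidableEq n] [Nonempty n]
    (h : IsVonNeumannRegularRing (Matrix n n R)) : IsVonNeumannRegularRing R := fun r => by
  let p : n := Classical.arbitrary n
  obtain ⟨b, hb⟩ := h (Matrix.single p p r)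
  refine ⟨b p p, ?_⟩
  simpa [Matrix.mul_apply, Matrix.single_apply] using congrFun (congrFun hb p) p

end VonNeumannRegular

/-! ### Descent from a matrix ring to its coefficients -/

section Matrix

variable {R : Type u} [Ring R] {n : Type v} [Fintype n] [DecidableEq n] [Nonempty n]

/-- Sending a left ideal to the matrices with entries in it is strictly monotone, so chain
conditions descend. -/
theorem IsNoetherianRing.of_matrix (h : IsNoetherianRing (Matrix n n R)) : IsNoetherianRing R := by
  rw [isNoetherianRing_iff, isNoetherian_iff'] at *
  exact (Ideal.matrix_strictMono_of_nonempty (R := R) n).wellFoundedGT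

theorem IsArtinianRing.of_matrix (h : IsArtinianRing (Matrix n n R)) : IsArtinianRing R := by
  rw [isArtinianRing_iff] at *
  exact (Ideal.matrix_strictMono_of_nonempty (R := R) n).wellFoundedLT

/-- Semisimple means artinian with zero Jacobson radical. Matrices with entries in the radical of
$R$ lie in the radical of the matrix ring, which is zero. -/
theorem IsSemisimpleRing.of_matrix (h : IsSemisimpleRing (Matrix n n R)) : IsSemisimpleRing R := by
  have : IsArtinianRing R := IsArtinianRing.of_matrix (n := n) inferInstance
  have h1 := Ideal.matrix_jacobson_le (n := n) (⊥ : Ideal R)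
  rw [Ideal.matrix_bot, Ideal.jacobson_bot, Ideal.jacobson_bot,
    IsSemisimpleRing.jacobson_eq_bot (R := Matrix n n R),
    ← Ideal.matrix_bot] at h1
  rw [IsArtinianRing.isSemisimpleRing_iff_jacobson, ← le_bot_iff]
  let p : n := Classical.arbitrary n
  exact fun x hx => h1 (x := Matrix.of fun _ _ => x) (fun _ _ => hx) p p

end Matrix

/-! ### Transfer between the coefficients and a product of matrix rings -/

section PiMatrix

variable {R : Type u} [Ring R] {I : Type v} [Finite I] [Nonempty I] {P : I → Type w}
  [∀ i, Fintype (P i)] [∀ i, DecidableEq (P i)] [∀ i, Nonempty (P i)]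
  {A : Type*} [Ring A] (e : A ≃+* ∀ i, Matrix (P i) (P i) R)

include e

omit [Finite I] in
theorem IsVonNeumannRegularRing.iff_of_ringEquiv_pi_matrix :
    IsVonNeumannRegularRing R ↔ IsVonNeumannRegularRing A := by
  let i : I := Classical.arbitrary I
  constructor
  · intro h
    exact (IsVonNeumannRegularRing.pi fun i => h.matrix (P i)).of_surjective
      e.symm.toRingHom e.symm.surjective
  · intro h
    exact ((h.of_surjective e.toRingHom e.surjective).of_surjective
      (Pi.evalRingHom (fun i => Matrix (P i) (P i) R) i) (Function.surjective_eval i)).of_matrix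

theorem IsNoetherianRing.iff_of_ringEquiv_pi_matrix :
    IsNoetherianRing R ↔ IsNoetherianRing A := by
  let i : I := Classical.arbitrary I
  constructor
  · intro h
    exact isNoetherianRing_of_ringEquiv _ e.symm
  · intro h
    have := isNoetherianRing_of_ringEquiv _ e
    exact (isNoetherianRing_of_surjective _ _
      (Pi.evalRingHom (fun i => Matrix (P i) (P i) R) i) (Function.surjective_eval i)).of_matrix

theorem IsArtinianRing.iff_of_ringEquiv_pi_matrix :
    IsArtinianRing R ↔ IsArtinianRing A := by
  let i : I := Classical.arbitrary I
  constructor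
  · intro h
    exact e.symm.surjective.isArtinianRing
  · intro h
    have := e.surjective.isArtinianRing
    exact (Function.Surjective.isArtinianRing
      (f := Pi.evalRingHom (fun i => Matrix (P i) (P i) R) i) (Function.surjective_eval i)).of_matrix

theorem IsSemisimpleRing.iff_of_ringEquiv_pi_matrix :
    IsSemisimpleRing R ↔ IsSemisimpleRing A := by
  let i : I := Classical.arbitrary I
  constructor
  · intro h
    exact e.symm.toRingHom.isSemisimpleRing_of_surjective e.symm.surjective
  · intro h
    have := e.toRingHom.isSemisimpleRing_of_surjective e.surjective
    exact ((Pi.evalRingHom (fun i => Matrix (P i) (P i) R) i).isSemisimpleRing_of_surjective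
      (Function.surjective_eval i)).of_matrix

/-- The opposite of a product of matrix rings is the product of the matrix rings over the
opposite ring. -/
noncomputable def RingEquiv.opPiMatrix : Aᵐᵒᵖ ≃+* ∀ i, Matrix (P i) (P i) Rᵐᵒᵖ :=
  (e.op.trans (.piMulOpposite _)).trans (.piCongrRight fun _ => .symm .mopMatrix)

/-- The idempotent with one diagonal unit $E_{pp}$ in each block cuts out one copy of $R$ per block,
so $k$ is the number of blocks. -/
theorem IsMoritaEquivalent.of_ringEquiv_pi_matrix :
    ∃ k : ℕ, 0 < k ∧ IsMoritaEquivalent ℤ A (Fin k → R) := by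
  classical
  obtain ⟨k, ⟨f⟩⟩ := Finite.exists_equiv_fin I
  have hk : 0 < k := Fin.pos_iff_nonempty.2 f.symm.nonempty
  let p (i : I) : P i := Classical.arbitrary _
  have := Fintype.ofFinite I
  let g := (Fintype.equivFin (Σ i, P i)).symm
  let c (a : A) (i : I) : R := e a i (p i) (p i)
  let φ : (Fin k → R) →ₙ+* ∀ i, Matrix (P i) (P i) R :=
    { toFun := fun r i => Matrix.single (p i) (p i) (r (f i))
      map_mul' := fun r s => funext fun i => by simp
      map_zero' := funext fun i => by simp
      map_add' := fun r s => funext fun i => by simp [Matrix.single_add] }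
  refine ⟨k, hk, FullCorner.isMoritaEquivalent
    { incl := (e.symm : _ →ₙ+* A).comp φ
      incl_injective := e.symm.injective.comp fun r s h => funext fun j => by
        have h1 := congrFun (congrFun (congrFun h (f.symm j)) (p _)) (p _)
        simpa [φ] using h1
      compr := fun a j => c a (f.symm j)
      incl_compr := fun a => e.injective <| by
        change e (e.symm _) = e (e.symm _ * a * e.symm _)
        rw [map_mul, map_mul, e.apply_symm_apply, e.apply_symm_apply]
        refine funext fun i => ?_
        change Matrix.single (p i) (p i) (c a (f.symm (f i))) =
          Matrix.single (p i) (p i) 1 * e a i * Matrix.single (p i) (p i) 1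
        simp [c]
      n := Fintype.card (Σ i, P i)
      x := fun j => e.symm (Pi.single (g j).1 (Matrix.single (g j).2 (p _) 1))
      y := fun j => e.symm (Pi.single (g j).1 (Matrix.single (p _) (g j).2 1))
      sum_eq_one := by
        -- Fullness: $E_{qp} E_{pp} E_{pq} = E_{qq}$, and the diagonal units of all blocks add up to
        -- $1$.
        have h (z : Σ i, P i) : e.symm (Pi.single z.1 (Matrix.single z.2 (p z.1) 1)) *
            e.symm (φ 1) * e.symm (Pi.single z.1 (Matrix.single (p z.1) z.2 1)) =
              e.symm (Pi.single z.1 (Matrix.single z.2 z.2 1)) := by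
          rw [← map_mul, ← map_mul, ← Pi.single_mul_left, ← Pi.single_mul]
          congr 2
          change Matrix.single _ _ _ * Matrix.single (p z.1) (p z.1) 1 * Matrix.single _ _ _ = _
          simp
        refine (Fintype.sum_congr _ _ fun j => h (g j)).trans ?_
        rw [g.sum_comp fun z => e.symm (Pi.single z.1 (Matrix.single z.2 z.2 1)),
          ← map_sum, Fintype.sum_sigma, EmbeddingLike.map_eq_one_iff]
        refine Eq.trans ?_ (Finset.univ_sum_single 1)
        refine Finset.sum_congr rfl fun i _ => ?_
        rw [Pi.one_apply, ← Matrix.sum_single_one]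
        exact (map_sum (AddMonoidHom.single (fun i => Matrix (P i) (P i) R) i) _ _).symm }⟩

end PiMatrix

/-! ### Recognizing products of matrix rings by matrix units -/

/-- A ring that is additively spanned by scaled matrix units `m i p q t` is a product of matrix
rings. -/
theorem RingEquiv.nonempty_pi_matrix {R A I : Type*} {P : I → Type*} [Ring R] [Ring A] [Finite I]
    [∀ i, Fintype (P i)] [∀ i, DecidableEq (P i)] (m : ∀ i, P i → P i → R →+ A)
    (h_self : ∀ i p q r s t u, m i p q t * m i r s u = if q = r then m i p s (t * u) else 0)
    (h_ne : ∀ i j, i ≠ j → ∀ p q r s t u, m i p q t * m j r s u = 0)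
    (h_span : AddSubgroup.closure {x | ∃ i p q t, x = m i p q t} = ⊤)
    (h_inj : ∀ i p t, m i p p t = 0 → t = 0) :
    Nonempty (A ≃+* ∀ i, Matrix (P i) (P i) R) := by
  classical
  have := Fintype.ofFinite I
  let Φ : (∀ i, Matrix (P i) (P i) R) →+ A :=
    { toFun := fun M => ∑ i, ∑ p, ∑ q, m i p q (M i p q)
      map_zero' := by simp
      map_add' := fun M N => by simp [Finset.sum_add_distrib] }
  have hΦ (M) : Φ M = ∑ i, ∑ p, ∑ q, m i p q (M i p q) := rfl
  have hl (i p q t N) : m i p q t * Φ N = ∑ s, m i p s (t * N i q s) := by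
    simp only [hΦ, Finset.mul_sum]
    rw [Finset.sum_eq_single i]
    · simp [h_self]
    · intro j _ hj
      simp [h_ne i j hj.symm]
    · simp
  have hr (i r s u M) : Φ M * m i r s u = ∑ p, m i p s (M i p r * u) := by
    simp only [hΦ, Finset.sum_mul]
    rw [Finset.sum_eq_single i]
    · simp [h_self]
    · intro j _ hj
      simp [h_ne j i hj]
    · simp
  -- The image of $1$ is a left identity on the spanning matrix units, hence on $A$, and so equals
  -- $1$.
  have h_one : Φ 1 = 1 := by
    have key (x : A) : Φ 1 * x = x := by
      have hx : x ∈ AddSubgroup.closure {x | ∃ i p q t, x = m i p q t} := h_span ▸ trivial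
      induction hx using AddSubgroup.closure_induction with
      | mem x hx =>
        obtain ⟨i, p, q, t, rfl⟩ := hx
        rw [hr, Finset.sum_eq_single p]
        · simp
        · intro r _ hrp
          simp [Matrix.one_apply_ne hrp]
        · simp
      | zero => simp
      | add x y _ _ hx hy => rw [mul_add, hx, hy]
      | neg x _ hx => rw [mul_neg, hx]
    rw [← key 1, mul_one]
  have h_mul (M N) : Φ (M * N) = Φ M * Φ N := by
    rw [hΦ M]
    simp only [Finset.sum_mul, hl]
    rw [hΦ]
    refine Finset.sum_congr rfl fun i _ => Finset.sum_congr rfl fun p _ => ?_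
    rw [Finset.sum_comm]
    refine Finset.sum_congr rfl fun q _ => ?_
    rw [Pi.mul_apply, Matrix.mul_apply, map_sum]
  let Ψ : (∀ i, Matrix (P i) (P i) R) →+* A :=
    { Φ with
      map_one' := h_one
      map_mul' := h_mul }
  refine ⟨(RingEquiv.ofBijective Ψ ⟨?_, fun x => ?_⟩).symm⟩
  · rw [injective_iff_map_eq_zero]
    intro M hM
    replace hM : Φ M = 0 := hM
    ext i p q
    apply h_inj i p
    -- Multiplying by the units $(p,p)$ on the left and $(q,p)$ on the right moves the single entry
    -- $M_{pq}$ to the diagonal position where `h_inj` applies.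
    have h := hl i p p 1 M
    rw [hM, mul_zero] at h
    have h' := congrArg (· * m i q p 1) h
    simp only [zero_mul, Finset.sum_mul, h_self] at h'
    simpa using h'.symm
  · have hx : x ∈ AddSubgroup.closure {x | ∃ i p q t, x = m i p q t} := h_span ▸ trivial
    induction hx using AddSubgroup.closure_induction with
    | mem x hx =>
      obtain ⟨i, p, q, t, rfl⟩ := hx
      refine ⟨Pi.single i (Matrix.single p q t), ?_⟩
      change Φ _ = _
      rw [hΦ, Finset.sum_eq_single i, Finset.sum_eq_single p, Finset.sum_eq_single q]
      · simp
      · intro r _ hr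
        simp [hr.symm]
      · simp
      · intro r _ hr
        simp [hr.symm]
      · simp
      · intro j _ hj
        simp [hj]
      · simp
    | zero => exact ⟨0, map_zero _⟩
    | add x y _ _ hx hy =>
      obtain ⟨a, rfl⟩ := hx
      obtain ⟨b, rfl⟩ := hy
      exact ⟨a + b, map_add _ _ _⟩
    | neg x _ hx =>
      obtain ⟨a, rfl⟩ := hx
      exact ⟨-a, map_neg _ _⟩

namespace DirectedGraph

variable {V : Type v} {E : Type w} {G : DirectedGraph V E}

/-! ### Paths in graphs without exits -/

theorem IsPath.range_unique {a b c : V} {l : List E} (h : G.IsPath a l b) (h' : G.IsPath a l c) :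
    b = c := by
  induction l generalizing a with
  | nil => exact h.symm.trans h'
  | cons e l ih => exact ih h.2 h'.2

theorem isPath_append_iff {a c : V} {l m : List E} :
    G.IsPath a (l ++ m) c ↔ ∃ b, G.IsPath a l b ∧ G.IsPath b m c := by
  induction l generalizing a with
  | nil => simp [IsPath]
  | cons e l ih => simp [IsPath, ih, and_assoc]

theorem isPath_concat_iff {a c : V} {l : List E} {e : E} :
    G.IsPath a (l ++ [e]) c ↔ G.IsPath a l (G.src e) ∧ G.rng e = c := by
  rw [isPath_append_iff]
  constructor
  · rintro ⟨b, h, rfl, h'⟩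
    exact ⟨h, h'⟩
  · rintro ⟨h, h'⟩
    exact ⟨_, h, rfl, h'⟩

variable (G) in
/-- A vertex lies on a closed path if it is the source and the range of a non-empty path. -/
def OnClosedPath (a : V) : Prop := ∃ l, l ≠ [] ∧ G.IsPath a l a

/-- A shortest closed path is a cycle. -/
theorem OnClosedPath.exists_isCycle {a : V} (h : G.OnClosedPath a) :
    ∃ e l, G.IsCycle (e :: l) ∧ G.IsPath a (e :: l) a := by
  obtain ⟨l, hl, hp⟩ := h
  induction hn : l.length using Nat.strong_induction_on generalizing l with
  | _ n ih =>
    obtain _ | ⟨e, l⟩ := l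
    · exact absurd rfl hl
    · by_cases hc : ∀ f ∈ l, G.src f ≠ a
      · exact ⟨e, l, ⟨by simp, a, hp, hc⟩, hp⟩
      · push Not at hc
        obtain ⟨f, hf, hfa⟩ := hc
        -- The path returns to $a$ before its end, so the part from that return onwards is a shorter
        -- closed path.
        obtain ⟨l₁, l₂, rfl⟩ := List.append_of_mem hf
        obtain ⟨b, -, hb⟩ := isPath_append_iff.1 hp.2
        obtain rfl : b = a := hb.1.symm.trans hfa
        exact ih (f :: l₂).length (by subst hn; simp) (f :: l₂) (by simp) hb rfl

/-- Some cycle starts at $a$, and an edge leaving $a$ other than its first edge would be an exit.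
Hence a vertex on a closed path emits only one edge. -/
theorem ConditionNE.eq_of_isPath_cons (hG : G.ConditionNE) {a : V} {e f : E} {l : List E}
    (hp : G.IsPath a (e :: l) a) (hf : G.src f = a) : f = e := by
  have hc : ∃ e' l', G.IsCycle (e' :: l') ∧ G.IsPath a (e' :: l') a :=
    OnClosedPath.exists_isCycle ⟨e :: l, by simp, hp⟩
  obtain ⟨e', l', hc, hp'⟩ := hc
  have key (g : E) (hg : G.src g = a) : g = e' := by
    by_contra hne
    exact hG ⟨e' :: l', g, hc, e', by simp, hg.trans hp'.1.symm, hne⟩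
  rw [key f hf, key e hp.1]

theorem ConditionNE.eq_of_src_eq (hG : G.ConditionNE) {e f : E}
    (h : G.OnClosedPath (G.src e)) (hf : G.src f = G.src e) : f = e := by
  obtain ⟨l, hl, hp⟩ := h
  obtain _ | ⟨g, l⟩ := l
  · exact absurd rfl hl
  · rw [hG.eq_of_isPath_cons hp rfl, hG.eq_of_isPath_cons hp hf]

/-- The only edge leaving the source is the first edge of the closed path; rotating that path by one
step closes it at the range. -/
theorem ConditionNE.onClosedPath_rng (hG : G.ConditionNE) {e : E}
    (h : G.OnClosedPath (G.src e)) : G.OnClosedPath (G.rng e) := by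
  obtain ⟨l, hl, hp⟩ := h
  obtain _ | ⟨g, l⟩ := l
  · exact absurd rfl hl
  · obtain rfl := hG.eq_of_isPath_cons hp rfl
    exact ⟨l ++ [e], by simp, isPath_concat_iff.2 ⟨hp.2, rfl⟩⟩

theorem ConditionNE.onClosedPath_of_isPath (hG : G.ConditionNE) {a b : V} {l : List E}
    (h : G.OnClosedPath a) (hl : G.IsPath a l b) : G.OnClosedPath b := by
  induction l generalizing a with
  | nil => exact hl ▸ h
  | cons e l ih =>
    obtain ⟨rfl, hl⟩ := hl
    exact ih (hG.onClosedPath_rng h) hl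

/-- A path into a vertex not on a closed path visits no vertex twice. -/
theorem ConditionNE.card_add_length_le [Finite V] (hG : G.ConditionNE) {a b : V} {l : List E}
    (hl : G.IsPath a l b) (hb : ¬ G.OnClosedPath b) (s : Finset V)
    (hs : ∀ x ∈ s, ∃ m, m ≠ [] ∧ G.IsPath x m a) : s.card + l.length ≤ Nat.card V := by
  classical
  induction l generalizing a s with
  | nil =>
    have := Fintype.ofFinite V
    rw [Nat.card_eq_fintype_card]
    exact s.card_le_univ
  | cons e l ih =>
    -- The set $s$ collects the vertices already visited. Revisiting one would put $a$, and hence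
    -- every later vertex including $b$, on a closed path.
    have ha : a ∉ s := fun h => hb (hG.onClosedPath_of_isPath (hs a h) hl)
    obtain ⟨rfl, hl⟩ := hl
    have := ih hl (insert (G.src e) s) fun x hx => by
      rcases Finset.mem_insert.1 hx with rfl | hx
      · exact ⟨[e], by simp, rfl, rfl⟩
      · obtain ⟨m, -, hm⟩ := hs x hx
        exact ⟨m ++ [e], by simp, isPath_concat_iff.2 ⟨hm, rfl⟩⟩
    rw [Finset.card_insert_of_notMem ha] at this
    simp only [List.length_cons]
    omega

theorem ConditionNE.onClosedPath_of_card_lt_length [Finite V] (hG : G.ConditionNE) {a b : V}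
    {l : List E} (hl : G.IsPath a l b) (h : Nat.card V < l.length) : G.OnClosedPath b := by
  by_contra hb
  have := hG.card_add_length_le hl hb ∅ (by simp)
  simp only [Finset.card_empty] at this
  omega

/-- Among the edges with source on a closed path, an edge is determined by its range. -/
theorem ConditionNE.eq_of_rng_eq [Finite V] (hG : G.ConditionNE) {e f : E}
    (he : G.OnClosedPath (G.src e)) (hf : G.OnClosedPath (G.src f)) (h : G.rng e = G.rng f) :
    e = f := by
  have key (x : {a // G.OnClosedPath a}) : ∃ g, G.src g = x.1 := by
    obtain ⟨a, l, hl, hp⟩ := x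
    obtain _ | ⟨g, l⟩ := l
    · exact absurd rfl hl
    · exact ⟨g, hp.1⟩
  choose next hnext using key
  -- The successor map along the unique outgoing edge. It is surjective, the last edge of a closed
  -- path at $a$ giving a preimage of $a$, hence injective by finiteness.
  let σ (x : {a // G.OnClosedPath a}) : {a // G.OnClosedPath a} :=
    ⟨G.rng (next x), hG.onClosedPath_rng ((hnext x).symm ▸ x.2)⟩
  have hσ : Function.Surjective σ := by
    rintro ⟨a, l, hl, hp⟩
    obtain ⟨l', g, rfl⟩ := (List.eq_nil_or_concat' l).resolve_left hl
    have ha : G.OnClosedPath a := ⟨_, hl, hp⟩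
    obtain ⟨hp, hg⟩ := isPath_concat_iff.1 hp
    have hs : G.OnClosedPath (G.src g) := hG.onClosedPath_of_isPath ha hp
    refine ⟨⟨G.src g, hs⟩, Subtype.ext ?_⟩
    change G.rng (next _) = a
    rw [hG.eq_of_src_eq hs (hnext ⟨_, hs⟩), hg]
  have hinj := Finite.injective_iff_surjective.2 hσ
  have h1 : σ ⟨G.src e, he⟩ = σ ⟨G.src f, hf⟩ := Subtype.ext <| by
    change G.rng (next _) = G.rng (next _)
    rw [hG.eq_of_src_eq he (hnext ⟨_, he⟩), hG.eq_of_src_eq hf (hnext ⟨_, hf⟩), h]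
  exact hG.eq_of_src_eq hf (congrArg Subtype.val (hinj h1))

end DirectedGraph

/-! ### A faithful enough representation of the Leavitt path algebra -/

namespace DirectedGraph

variable {V : Type v} {E : Type w} (G : DirectedGraph V E)

/-- For every vertex `a` that is not a sink, `ℕ` decomposes into copies of `ℕ` indexed by the edges
with source `a`. -/
theorem exists_branching [Finite E] : ∃ ι : E → ℕ → ℕ,
    (∀ e f m n, G.src e = G.src f → ι e m = ι f n → e = f ∧ m = n) ∧
    ∀ e n, ∃ f m, G.src f = G.src e ∧ ι f m = n := by
  have h (a : V) : ∃ g : {e // G.src e = a} × ℕ → ℕ,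
      g.Injective ∧ (Nonempty {e // G.src e = a} → g.Surjective) := by
    rcases isEmpty_or_nonempty {e // G.src e = a} with ha | ha
    · exact ⟨fun _ => 0, Function.injective_of_subsingleton _, fun h => (ha.false h.some).elim⟩
    · obtain ⟨g⟩ : Nonempty ({e // G.src e = a} × ℕ ≃ ℕ) := nonempty_equiv_of_countable
      exact ⟨g, g.injective, fun _ => g.surjective⟩
  choose enc hinj hsurj using h
  have h1 (e : E) (a : V) (n : ℕ) (he : G.src e = a) :
      enc (G.src e) (⟨e, rfl⟩, n) = enc a (⟨e, he⟩, n) := by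
    subst he
    rfl
  refine ⟨fun e n => enc (G.src e) (⟨e, rfl⟩, n), fun e f m n hef h => ?_, fun e n => ?_⟩
  · have := hinj _ ((h1 e _ m hef).symm.trans h)
    simpa using this
  · obtain ⟨⟨⟨f, hf⟩, m⟩, hfm⟩ := hsurj (G.src e) ⟨e, rfl⟩ n
    exact ⟨f, m, hf, (h1 f _ m hf).trans hfm⟩

end DirectedGraph

namespace LeavittPathAlgebra

open LeavittFree MonoidAlgebra

variable (R : Type u) [Ring R] {V : Type v} {E : Type w} (G : DirectedGraph V E)

open Classical in
/-- The action of the symbols on functions `V → ℕ → R`. -/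
noncomputable def genAction (ι : E → ℕ → ℕ) : LeavittGen V E → AddMonoid.End (V → ℕ → R)
  | .vert a => (AddMonoidHom.single (fun _ => ℕ → R) a).comp (Pi.evalAddMonoidHom _ a)
  | .edge e => (AddMonoidHom.single (fun _ => ℕ → R) (G.src e)).comp
      ((Function.ExtendByZero.hom R (ι e)).comp (Pi.evalAddMonoidHom _ (G.rng e)))
  | .ghost e => (AddMonoidHom.single (fun _ => ℕ → R) (G.rng e)).comp
      ((AddMonoidHom.pi fun n => Pi.evalAddMonoidHom (fun _ => R) (ι e n)).comp
        (Pi.evalAddMonoidHom _ (G.src e)))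

section

variable {R} (ι : E → ℕ → ℕ)

open Classical in
theorem genAction_vert (a : V) (f : V → ℕ → R) :
    genAction R G ι (.vert a) f = Pi.single a (f a) := rfl

open Classical in
theorem genAction_edge (e : E) (f : V → ℕ → R) :
    genAction R G ι (.edge e) f = Pi.single (G.src e) (Function.extend (ι e) (f (G.rng e)) 0) := rfl

open Classical in
theorem genAction_ghost (e : E) (f : V → ℕ → R) :
    genAction R G ι (.ghost e) f = Pi.single (G.rng e) (fun n => f (G.src e) (ι e n)) := rfl

/-- Symbols only move or erase entries, while coefficients multiply them on the left; they commute
even over a non-commutative $R$, as the free algebra requires. -/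
theorem genAction_smul (x : LeavittGen V E) (t : R) (f : V → ℕ → R) :
    genAction R G ι x (t • f) = t • genAction R G ι x f := by
  classical
  cases x with
  | vert a => rw [genAction_vert, genAction_vert, ← Pi.single_smul, Pi.smul_apply]
  | edge e =>
    rw [genAction_edge, genAction_edge, ← Pi.single_smul, Pi.smul_apply]
    congr 1
    ext n
    simp only [Function.extend_def, Pi.smul_apply]
    split_ifs <;> simp
  | ghost e => rw [genAction_ghost, genAction_ghost, ← Pi.single_smul]; rfl

/-- The action of words. -/
noncomputable def wordAction : FreeSemigroup (LeavittGen V E) →ₙ* AddMonoid.End (V → ℕ → R) :=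
  FreeSemigroup.lift (genAction R G ι)

theorem wordAction_mul (x y : FreeSemigroup (LeavittGen V E)) (f : V → ℕ → R) :
    wordAction G ι (x * y) f = wordAction G ι x (wordAction G ι y f) := by
  rw [map_mul]
  rfl

theorem wordAction_smul (x : FreeSemigroup (LeavittGen V E)) (t : R) (f : V → ℕ → R) :
    wordAction G ι x (t • f) = t • wordAction G ι x f := by
  induction x using FreeSemigroup.recOnMul generalizing f with
  | ih1 x => exact genAction_smul G ι x t f
  | ih2 x y h1 h2 =>
    rw [wordAction_mul, wordAction_mul, h2, h1]

/-- The action of the free algebra. -/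
noncomputable def freeAction : LeavittFree R V E →+ AddMonoid.End (V → ℕ → R) :=
  MonoidAlgebra.liftNC (Module.toAddMonoidEnd R (V → ℕ → R) : R →+ _) (wordAction G ι)

theorem freeAction_single (x : FreeSemigroup (LeavittGen V E)) (t : R) (f : V → ℕ → R) :
    freeAction G ι (single x t) f = t • wordAction G ι x f := by
  rw [freeAction, MonoidAlgebra.liftNC_single]
  rfl

theorem freeAction_sum {κ : Type*} (s : Finset κ) (x : κ → LeavittFree R V E) (f : V → ℕ → R) :
    freeAction G ι (∑ j ∈ s, x j) f = ∑ j ∈ s, freeAction G ι (x j) f := by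
  rw [map_sum]
  exact AddMonoidHom.finsetSum_apply (N := V → ℕ → R) _ _ _

theorem freeAction_mul (x y : LeavittFree R V E) :
    freeAction G ι (x * y) = freeAction G ι x * freeAction G ι y := by
  refine MonoidAlgebra.liftNC_mul (Module.toAddMonoidEnd R (V → ℕ → R)) (wordAction G ι) x y
    fun {w z} _ => ?_
  ext1 f
  exact (wordAction_smul G ι z _ f).symm

/-- An edge spreads a sequence over the image of $\iota_e$ and its ghost reads it back. Injectivity
and disjointness of the images for edges with one source give (c); that they cover $\mathbb{N}$
gives (d). -/
theorem freeAction_eq_of_rel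
    (h1 : ∀ e f m n, G.src e = G.src f → ι e m = ι f n → e = f ∧ m = n)
    (h2 : ∀ e n, ∃ f m, G.src f = G.src e ∧ ι f m = n) {x y : LeavittFree R V E}
    (h : G.LeavittRel R x y) : freeAction G ι x = freeAction G ι y := by
  classical
  have hinj (e : E) : Function.Injective (ι e) := fun m n h => (h1 e e m n rfl h).2
  have hw (g : LeavittGen V E) : wordAction (R := R) G ι (FreeSemigroup.of g) = genAction R G ι g :=
    rfl
  ext1 f
  cases h with
  | vert_self t a => simp [freeAction_single, hw, genAction_vert]
  | vert_ne t a b h => simp [freeAction_single, hw, genAction_vert, h]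
  | src_edge t e => simp [freeAction_single, hw, genAction_vert, genAction_edge]
  | edge_rng t e => simp [freeAction_single, hw, genAction_vert, genAction_edge]
  | rng_ghost t e => simp [freeAction_single, hw, genAction_vert, genAction_ghost]
  | ghost_src t e => simp [freeAction_single, hw, genAction_vert, genAction_ghost]
  | ghost_edge_self t e =>
    simp [freeAction_single, hw, genAction_vert, genAction_ghost, genAction_edge,
      (hinj e).extend_apply]
  | ghost_edge_ne t e e' h =>
    simp only [freeAction_single, wordAction_mul, hw, genAction_ghost,
      genAction_edge, map_zero, AddMonoid.End.zero_apply]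
    suffices h : (fun n => (Pi.single (G.src e') (Function.extend (ι e') (f (G.rng e')) 0) :
        V → ℕ → R) (G.src e) (ι e n)) = 0 by rw [h, Pi.single_zero, smul_zero]
    ext n
    by_cases hs : G.src e = G.src e'
    · rw [← hs, Pi.single_eq_same, Function.extend_apply']
      · rfl
      · rintro ⟨m, hm⟩
        exact h (h1 e e' n m hs hm.symm).1
    · rw [Pi.single_eq_of_ne hs]
      rfl
  | sum_edge_ghost t a hfin hne =>
    rw [freeAction_sum, freeAction_single]
    simp only [freeAction_single, wordAction_mul, hw, genAction_ghost,
      genAction_edge, genAction_vert, Pi.single_eq_same]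
    rw [← Finset.smul_sum]
    congr 1
    obtain ⟨e₀, rfl⟩ := hne
    have h3 : ∀ e ∈ hfin.toFinset, (Pi.single (G.src e) (Function.extend (ι e)
        (fun n => f (G.src e) (ι e n)) 0) : V → ℕ → R) =
        Pi.single (G.src e₀) (Function.extend (ι e) (fun n => f (G.src e₀) (ι e n)) 0) := by
      intro e he
      have he : G.src e = G.src e₀ := by simpa using he
      rw [he]
    rw [Finset.sum_congr rfl h3]
    refine (map_sum (AddMonoidHom.single (fun _ : V => ℕ → R) (G.src e₀)) _ _).symm.trans ?_
    change Pi.single _ _ = _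
    congr 1
    ext n
    obtain ⟨e, m, he, rfl⟩ := h2 e₀ n
    rw [Finset.sum_apply, Finset.sum_eq_single e]
    · rw [(hinj e).extend_apply]
    · intro e' he' hne
      have he' : G.src e' = G.src e₀ := by simpa using he'
      rw [Function.extend_apply']
      · rfl
      · rintro ⟨m', hm'⟩
        exact hne (h1 e' e m' m (he'.trans he.symm) hm').1
    · intro h
      exact absurd (by simpa using he) h

end

variable {R G} in
/-- A non-zero multiple of a vertex is non-zero in the Leavitt path algebra. -/
theorem eq_zero_of_mk_single_vert_eq_zero [Finite E] {a : V} {t : R}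
    (h : mk R G (single (vert a) t) = 0) : t = 0 := by
  classical
  obtain ⟨ι, h1, h2⟩ := G.exists_branching
  have key {x y : LeavittFree R V E} (h : RingConGen.Rel (G.LeavittRel R) x y) :
      freeAction G ι x = freeAction G ι y := by
    induction h with
    | of x y h => exact freeAction_eq_of_rel G ι h1 h2 h
    | refl x => rfl
    | symm _ h => exact h.symm
    | trans _ _ h h' => exact h.trans h'
    | add _ _ h h' => rw [map_add, map_add, h, h']
    | mul _ _ h h' => rw [freeAction_mul, freeAction_mul, h, h']
  have h3 : freeAction G ι (single (vert a) t) = freeAction G ι 0 :=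
    key ((RingCon.eq (ringConGen (G.LeavittRel R))).1 h)
  -- On the constant function $1$, the element $ta$ takes the value $t$ at vertex $a$.
  have h4 := congrFun (congrFun (DFunLike.congr_fun h3 (fun _ _ => 1)) a) 0
  rw [freeAction_single, map_zero] at h4
  have h5 : t * (Pi.single a (fun _ => 1) : V → ℕ → R) a 0 = 0 := h4
  simpa using h5

end LeavittPathAlgebra

namespace LeavittPathAlgebra

open LeavittFree MonoidAlgebra

variable {R : Type u} [Ring R] {V : Type v} {E : Type w} {G : DirectedGraph V E}

/-! ### Products and expansions of monomials -/

theorem monomial_eq_mul (t : R) (a : V) (l : List E) (b : V) (m : List E) :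
    monomial R G t a l b m =
      mk R G (single (realWord G a l) t) * mk R G (single (ghostWord G b m) 1) := by
  rw [← mk_single_mul, mul_one]
  rfl

theorem monomial_eq_mul' (t : R) (a : V) (l : List E) (b : V) (m : List E) :
    monomial R G t a l b m =
      mk R G (single (realWord G a l) 1) * mk R G (single (ghostWord G b m) t) := by
  rw [← mk_single_mul, one_mul]
  rfl

theorem ghostWord_cons_mul_realWord_cons (t : R) {a b : V} {e f : E} {l m : List E} :
    mk R G (single (ghostWord G a (e :: l) * realWord G b (f :: m)) t) =
      mk R G (single (ghostWord G (G.rng e) l) t) * mk R G (single (ghost e * edge f) 1) *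
        mk R G (single (realWord G (G.rng f) m) 1) := by
  rw [← mk_single_mul, ← mk_single_mul]
  simp [ghostWord, realWord, mul_assoc]

theorem ghostWord_cons_mul_realWord_cons_self (t : R) {a b c : V} {e : E} {l m : List E}
    (h : G.IsPath (G.rng e) l c) :
    mk R G (single (ghostWord G a (e :: l) * realWord G b (e :: m)) t) =
      mk R G (single (ghostWord G (G.rng e) l * realWord G (G.rng e) m) t) := by
  rw [ghostWord_cons_mul_realWord_cons, mk_eq_of_rel (.ghost_edge_self 1 e), ← mk_single_mul, mul_one,
    ghostWord_mul_vert t h, ← mk_single_mul, mul_one]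

theorem ghostWord_mul_realWord_self (t : R) {a c : V} {l : List E} (h : G.IsPath a l c) :
    mk R G (single (ghostWord G a l * realWord G a l) t) = mk R G (single (vert c) t) := by
  induction l generalizing a with
  | nil =>
    obtain rfl : a = c := h
    exact mk_eq_of_rel (.vert_self t a)
  | cons e l ih => rw [ghostWord_cons_mul_realWord_cons_self t h.2, ih h.2]

/-- Equal leading edges cancel, and the first differing pair gives $0$ by (c). Sources are compared
along with edges because an empty list does not determine its vertex. -/
theorem ghostWord_mul_realWord_of_ne (t : R) {a b c d : V} {l m : List E} (h : G.IsPath a l c)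
    (h' : G.IsPath b m d) (hlen : l.length = m.length) (hne : (a, l) ≠ (b, m)) :
    mk R G (single (ghostWord G a l * realWord G b m) t) = 0 := by
  induction l generalizing a b m with
  | nil =>
    obtain rfl := List.length_eq_zero_iff.1 hlen.symm
    refine (mk_eq_of_rel (.vert_ne t a b fun hab => hne (by rw [hab]))).trans (map_zero _)
  | cons e l ih =>
    obtain _ | ⟨f, m⟩ := m
    · simp at hlen
    by_cases hef : e = f
    · subst hef
      rw [ghostWord_cons_mul_realWord_cons_self t h.2]
      refine ih h.2 h'.2 (by simpa using hlen) fun h1 => hne ?_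
      rw [← h.1, ← h'.1, show l = m from (Prod.ext_iff.1 h1).2]
    · rw [ghostWord_cons_mul_realWord_cons, mk_eq_of_rel (.ghost_edge_ne 1 e f hef)]
      simp

/-- A non-zero product would make the longer path a continuation of the shorter one beyond the sink
$c$. -/
theorem ghostWord_mul_realWord_of_lt (t : R) {a b c d : V} {l m : List E} (h : G.IsPath a l c)
    (h' : G.IsPath b m d) (hlen : l.length < m.length) (hc : ∀ e, G.src e ≠ c) :
    mk R G (single (ghostWord G a l * realWord G b m) t) = 0 := by
  rcases ghostWord_mul_realWord t h h' with h0 | ⟨p, h1, h2, -⟩ | ⟨p, -, h2, -⟩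
  · exact h0
  · obtain _ | ⟨e, p⟩ := p
    · simp at h2
      omega
    · exact absurd h1.1 (hc e)
  · omega

theorem ghostWord_mul_realWord_of_gt (t : R) {a b c d : V} {l m : List E} (h : G.IsPath a l c)
    (h' : G.IsPath b m d) (hlen : m.length < l.length) (hd : ∀ e, G.src e ≠ d) :
    mk R G (single (ghostWord G a l * realWord G b m) t) = 0 := by
  rcases ghostWord_mul_realWord t h h' with h0 | ⟨p, -, h2, -⟩ | ⟨p, h1, h2, -⟩
  · exact h0
  · omega
  · obtain _ | ⟨e, p⟩ := p
    · simp at h2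
      omega
    · exact absurd h1.1 (hd e)

theorem monomial_mul_monomial (t s : R) (a : V) (l : List E) (b : V) (m : List E) (a' : V)
    (l' : List E) (b' : V) (m' : List E) :
    monomial R G t a l b m * monomial R G s a' l' b' m' =
      mk R G (single (realWord G a l) t) *
        mk R G (single (ghostWord G b m * realWord G a' l') 1) *
          mk R G (single (ghostWord G b' m') s) := by
  rw [monomial_eq_mul, monomial_eq_mul' s, ← one_mul (1 : R), mk_single_mul]
  simp only [mul_assoc, one_mul]

theorem realWord_mul_vert (t : R) {a c : V} {l : List E} (h : G.IsPath a l c) :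
    mk R G (single (realWord G a l * vert c) t) = mk R G (single (realWord G a l) t) := by
  simpa [realWord] using realWord_mul_realWord t h (m := []) rfl

theorem monomial_mul_monomial_self (t s : R) {a b c d : V} {l m n : List E}
    (hl : G.IsPath a l d) (hm : G.IsPath b m d) :
    monomial R G t a l b m * monomial R G s b m c n = monomial R G (t * s) a l c n := by
  rw [monomial_mul_monomial, ghostWord_mul_realWord_self 1 hm, ← mk_single_mul, mul_one,
    realWord_mul_vert t hl, ← mk_single_mul]
  rfl

theorem monomial_mul_monomial_eq_zero (t s : R) {a b a' b' : V} {l m l' m' : List E}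
    (h : mk R G (single (ghostWord G b m * realWord G a' l') 1) = 0) :
    monomial R G t a l b m * monomial R G s a' l' b' m' = 0 := by
  rw [monomial_mul_monomial, h, mul_zero, zero_mul]

theorem monomial_concat (t : R) {a b : V} {l m : List E} {e : E} (hl : G.IsPath a l (G.src e))
    (hm : G.IsPath b m (G.src e)) :
    monomial R G t a (l ++ [e]) b (m ++ [e]) = mk R G (single (realWord G a l) t) *
      mk R G (single (edge e * ghost e) 1) * mk R G (single (ghostWord G b m) 1) := by
  have he : G.IsPath (G.src e) [e] (G.rng e) := ⟨rfl, rfl⟩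
  have h1 : mk R G (single (realWord G (G.src e) [e]) 1) = mk R G (single (edge e) 1) :=
    mk_eq_of_rel (.edge_rng 1 e)
  have h2 : mk R G (single (ghostWord G (G.src e) [e]) 1) = mk R G (single (ghost e) 1) :=
    mk_eq_of_rel (.rng_ghost 1 e)
  rw [monomial_eq_mul, ← realWord_mul_realWord t hl he, ← ghostWord_mul_ghostWord 1 hm he,
    ← mul_one t, mk_single_mul, h1, ← one_mul (1 : R), mk_single_mul, mk_single_mul, h2]
  simp only [mul_assoc, mul_one]

/-- Relation (d) inserted at the common range. It lengthens monomials in general, and shortens them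
when the sum has one term. -/
theorem monomial_eq_sum (t : R) {a b c : V} {l m : List E} (hl : G.IsPath a l c)
    (hm : G.IsPath b m c) (hfin : {e | G.src e = c}.Finite) (hne : {e | G.src e = c}.Nonempty) :
    monomial R G t a l b m =
      ∑ e ∈ hfin.toFinset, monomial R G t a (l ++ [e]) b (m ++ [e]) := by
  have h : ∀ e ∈ hfin.toFinset, monomial R G t a (l ++ [e]) b (m ++ [e]) =
      mk R G (single (realWord G a l) t) *
        mk R G (single (edge e * ghost e) 1) * mk R G (single (ghostWord G b m) 1) := by
    intro e he
    obtain rfl : G.src e = c := by simpa using he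
    exact monomial_concat t hl hm
  rw [Finset.sum_congr rfl h, ← Finset.sum_mul, ← Finset.mul_sum, ← map_sum,
    mk_eq_of_rel (.sum_edge_ghost 1 c hfin hne), ← mk_single_mul, mul_one, realWord_mul_vert t hl,
    ← monomial_eq_mul]

/-- Since $\alpha^*(t\,\alpha\alpha^*)\alpha = t\,r(\alpha)$, the claim reduces to vertices. -/
theorem eq_zero_of_monomial_self_eq_zero [Finite E] {t : R} {a c : V} {l : List E}
    (hl : G.IsPath a l c) (h : monomial R G t a l a l = 0) : t = 0 := by
  apply eq_zero_of_mk_single_vert_eq_zero (G := G) (a := c)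
  calc mk R G (single (vert c) t)
      = mk R G (single (ghostWord G a l) 1) * monomial R G t a l a l *
          mk R G (single (realWord G a l) 1) := by
        rw [monomial_eq_mul, ← mul_assoc, ← mk_single_mul, mul_assoc, ← mk_single_mul,
          ghostWord_mul_realWord_self _ hl, ghostWord_mul_realWord_self _ hl, ← mk_single_mul,
          one_mul, mul_one, mul_one, mk_eq_of_rel (.vert_self t c)]
    _ = 0 := by rw [h, mul_zero, zero_mul]

/-! ### The component of degree zero for graphs without exits -/

section Structure

variable [Finite V] [Finite E] (hG : G.ConditionNE)

include hG

/-- Under Condition (NE) the component of degree zero is spanned by the `t α β*` with `α` and `β` of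
the same length `N`, or of the same length less than `N` and ending in a sink, provided that `N`
exceeds the number of vertices. -/
theorem homogeneousComponent_zero_le {N : ℕ} (hN : Nat.card V < N)
    {K : AddSubgroup (LeavittPathAlgebra R G)}
    (hK : ∀ (t : R) (a : V) (l : List E) (b : V) (m : List E) (c : V), G.IsPath a l c →
      G.IsPath b m c → l.length = m.length →
      (l.length = N ∨ l.length < N ∧ ∀ e, G.src e ≠ c) → monomial R G t a l b m ∈ K) :
    homogeneousComponent R G 0 ≤ K := by
  -- Length at most $N$, with $j$ edges missing: expand by (d) until length $N$ or a sink is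
  -- reached.
  have h1 (j : ℕ) : ∀ (t : R) (a : V) (l : List E) (b : V) (m : List E) (c : V), G.IsPath a l c →
      G.IsPath b m c → l.length = m.length → l.length + j = N → monomial R G t a l b m ∈ K := by
    induction j with
    | zero => exact fun t a l b m c hl hm hlen hj => hK t a l b m c hl hm hlen (.inl hj)
    | succ j ih =>
      intro t a l b m c hl hm hlen hj
      by_cases hc : ∀ e, G.src e ≠ c
      · exact hK t a l b m c hl hm hlen (.inr ⟨by omega, hc⟩)
      · push Not at hc
        rw [monomial_eq_sum t hl hm (Set.toFinite _) hc]
        refine K.sum_mem fun e he => ?_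
        obtain rfl : G.src e = c := by simpa using he
        exact ih t a _ b _ _ (DirectedGraph.isPath_concat_iff.2 ⟨hl, rfl⟩)
          (DirectedGraph.isPath_concat_iff.2 ⟨hm, rfl⟩) (by simpa using hlen)
          (by simp; omega)
  -- Length $N + j$: strip off a common last edge $j$ times.
  have h2 (j : ℕ) : ∀ (t : R) (a : V) (l : List E) (b : V) (m : List E) (c : V), G.IsPath a l c →
      G.IsPath b m c → l.length = m.length → l.length = N + j → monomial R G t a l b m ∈ K := by
    induction j with
    | zero => exact fun t a l b m c hl hm hlen hj => h1 0 t a l b m c hl hm hlen hj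
    | succ j ih =>
      intro t a l b m c hl hm hlen hj
      obtain ⟨l, e, rfl⟩ := (List.eq_nil_or_concat' l).resolve_left (by rintro rfl; simp at hj)
      obtain ⟨m, f, rfl⟩ := (List.eq_nil_or_concat' m).resolve_left (by rintro rfl; simp at hlen)
      simp only [List.length_append, List.length_singleton] at hlen hj
      obtain ⟨hl, he⟩ := DirectedGraph.isPath_concat_iff.1 hl
      obtain ⟨hm, hf⟩ := DirectedGraph.isPath_concat_iff.1 hm
      -- Without their last edges the paths still have at least $N > |E^0|$ edges, so both last
      -- edges start on closed paths; having the same range, they coincide.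
      have he' := hG.onClosedPath_of_card_lt_length hl (by omega)
      have hf' := hG.onClosedPath_of_card_lt_length hm (by omega)
      obtain rfl := hG.eq_of_rng_eq he' hf' (he.trans hf.symm)
      have h3 := ih t a l b m _ hl hm (by omega) (by omega)
      rwa [monomial_eq_sum t hl hm (Set.toFinite _) ⟨e, rfl⟩, Finset.sum_eq_single e] at h3
      · intro f hf hfe
        exact absurd (hG.eq_of_src_eq he' (by simpa using hf)) hfe
      · intro h
        simp at h
  refine (AddSubgroup.closure_le K).2 ?_
  rintro _ ⟨t, a, l, b, m, c, hl, hm, hlen, rfl⟩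
  rcases le_total l.length N with h | h
  · exact h1 (N - l.length) t a l b m c hl hm (by omega) (by omega)
  · exact h2 (l.length - N) t a l b m c hl hm (by omega) (by omega)

/-- Under Condition (NE) the component of degree zero is a finite product of matrix rings over the
coefficients. -/
theorem exists_ringEquiv_pi_matrix [Nonempty V] [Nontrivial R] :
    ∃ (I : Type v) (P : I → Type (max v w)) (_ : Finite I) (_ : Nonempty I)
      (_ : ∀ i, Fintype (P i)) (_ : ∀ i, DecidableEq (P i)) (_ : ∀ i, Nonempty (P i)),
      Nonempty (principalComponent R G ≃+* ∀ i, Matrix (P i) (P i) R) := by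
  classical
  obtain ⟨N, hN⟩ : ∃ N, Nat.card V < N := ⟨_, Nat.lt_succ_self _⟩
  -- A block is given by a length and a range, and its rows and columns by the paths with these
  -- data. Only inhabited blocks enter `I`, so no matrix size is zero.
  let Q (i : ℕ × V) (x : V × List E) : Prop :=
    G.IsPath x.1 x.2 i.2 ∧ x.2.length = i.1 ∧ (i.1 = N ∨ i.1 < N ∧ ∀ e, G.src e ≠ i.2)
  let I := {i : ℕ × V // ∃ x, Q i x}
  let P (i : I) := {x : V × List E // Q i.1 x}
  have hI : Finite I := by
    refine Set.Finite.subset ((Set.finite_Iic N).prod Set.finite_univ) ?_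
    rintro ⟨n, a⟩ ⟨x, -, -, hx⟩
    refine ⟨?_, trivial⟩
    simp only [Set.mem_Iic]
    omega
  have hP (i : I) : Finite (P i) := by
    refine Set.Finite.subset (Set.finite_univ.prod (List.finite_length_eq E i.1.1)) ?_
    rintro ⟨a, l⟩ ⟨-, hx, -⟩
    exact ⟨trivial, hx⟩
  have hP' (i : I) : Fintype (P i) := Fintype.ofFinite _
  have hP'' (i : I) : Nonempty (P i) := let ⟨x, hx⟩ := i.2; ⟨x, hx⟩
  let m (i : I) (p q : P i) : R →+ principalComponent R G :=
    { toFun := fun t => ⟨monomial R G t p.1.1 p.1.2 q.1.1 q.1.2, AddSubgroup.subset_closure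
        ⟨t, _, _, _, _, _, p.2.1, q.2.1, by rw [p.2.2.1, q.2.2.1, sub_self], rfl⟩⟩
      map_zero' := Subtype.ext <| by
        simp [monomial]
      map_add' := fun t s => Subtype.ext <| by
        simp [monomial] }
  obtain ⟨e⟩ := RingEquiv.nonempty_pi_matrix m
    (fun i p q r s t u => by
      apply Subtype.ext
      split_ifs with h
      · subst h
        exact monomial_mul_monomial_self t u p.2.1 q.2.1
      · exact monomial_mul_monomial_eq_zero t u <| ghostWord_mul_realWord_of_ne 1 q.2.1 r.2.1
          (q.2.2.1.trans r.2.2.1.symm) fun hqr => h (Subtype.ext hqr))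
    (fun i j hij p q r s t u => by
      apply Subtype.ext
      refine monomial_mul_monomial_eq_zero t u ?_
      have hq := q.2.2.1
      have hr := r.2.2.1
      -- For unequal lengths the shorter one is below $N$, so its path ends in a sink. For equal
      -- lengths the ranges differ, hence so do the paths.
      rcases lt_trichotomy i.1.1 j.1.1 with h | h | h
      · refine ghostWord_mul_realWord_of_lt 1 q.2.1 r.2.1 (by omega) ?_
        rcases q.2.2.2 with h' | h'
        · rcases r.2.2.2 with h'' | h'' <;> omega
        · exact h'.2
      · refine ghostWord_mul_realWord_of_ne 1 q.2.1 r.2.1 (by omega) fun hqr => hij ?_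
        have h1 := r.2.1
        rw [← (Prod.ext_iff.1 hqr).1, ← (Prod.ext_iff.1 hqr).2] at h1
        exact Subtype.ext (Prod.ext h (q.2.1.range_unique h1))
      · refine ghostWord_mul_realWord_of_gt 1 q.2.1 r.2.1 (by omega) ?_
        rcases r.2.2.2 with h' | h'
        · rcases q.2.2.2 with h'' | h'' <;> omega
        · exact h'.2)
    (by
      -- The spanning result concerns subgroups of $L_R(E)$, so the span of the matrix units is
      -- pushed forward along the inclusion.
      let φ : principalComponent R G →+ LeavittPathAlgebra R G :=
        { toFun := Subtype.val, map_zero' := rfl, map_add' := fun _ _ => rfl }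
      have h := homogeneousComponent_zero_le (R := R) hG hN
        (K := (AddSubgroup.closure {x | ∃ i p q t, x = m i p q t}).map φ)
        fun t a l b n c hl hn hlen hc => by
          let x : V × List E := (a, l)
          have hx : Q (l.length, c) x := ⟨hl, rfl, hc⟩
          exact ⟨m ⟨(l.length, c), x, hx⟩ ⟨x, hx⟩ ⟨(b, n), hn, hlen.symm, hc⟩ t,
            AddSubgroup.subset_closure ⟨_, _, _, _, rfl⟩, rfl⟩
      refine (AddSubgroup.eq_top_iff' _).2 fun x => ?_
      obtain ⟨y, hy, hyx⟩ := h x.2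
      rwa [← Subtype.ext hyx])
    (fun i p t h => eq_zero_of_monomial_self_eq_zero p.2.1 (congrArg Subtype.val h))
  -- With no blocks the product would be the zero ring, but a vertex is non-zero because $R$ is
  -- non-trivial.
  have hI' : Nonempty I := by
    by_contra hI'
    rw [not_nonempty_iff] at hI'
    have := e.injective.subsingleton
    obtain ⟨a⟩ := ‹Nonempty V›
    have h : (⟨_, vert_mem a⟩ : principalComponent R G) = 0 := Subsingleton.elim _ _
    exact one_ne_zero (eq_zero_of_mk_single_vert_eq_zero (congrArg Subtype.val h))
  exact ⟨I, P, hI, hI', hP', fun _ => inferInstance, hP'', ⟨e⟩⟩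

end Structure

end LeavittPathAlgebra

theorem mainTheorem7 {R : Type u} [Ring R] [Nontrivial R] {V : Type v} {E : Type w}
    [Finite V] [Nonempty V] [Finite E] (G : DirectedGraph V E) (hG : G.ConditionNE) :
    (∃ k : ℕ, 0 < k ∧
      IsMoritaEquivalent ℤ (LeavittPathAlgebra.principalComponent R G) (Fin k → R)) ∧
    (IsSemisimpleRing R ↔ IsSemisimpleRing (LeavittPathAlgebra.principalComponent R G)) ∧
    (IsVonNeumannRegularRing R ↔
      IsVonNeumannRegularRing (LeavittPathAlgebra.principalComponent R G)) ∧
    (IsNoetherianRing R ↔ IsNoetherianRing (LeavittPathAlgebra.principalComponent R G)) ∧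
    (IsNoetherianRing Rᵐᵒᵖ ↔
      IsNoetherianRing (LeavittPathAlgebra.principalComponent R G)ᵐᵒᵖ) ∧
    (IsArtinianRing R ↔ IsArtinianRing (LeavittPathAlgebra.principalComponent R G)) ∧
    (IsArtinianRing Rᵐᵒᵖ ↔
      IsArtinianRing (LeavittPathAlgebra.principalComponent R G)ᵐᵒᵖ) := by
  obtain ⟨I, P, _, _, _, _, _, ⟨e⟩⟩ :=
    LeavittPathAlgebra.exists_ringEquiv_pi_matrix (R := R) hG
  exact ⟨IsMoritaEquivalent.of_ringEquiv_pi_matrix e, IsSemisimpleRing.iff_of_ringEquiv_pi_matrix e,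
    IsVonNeumannRegularRing.iff_of_ringEquiv_pi_matrix e,
    IsNoetherianRing.iff_of_ringEquiv_pi_matrix e,
    -- Right conditions are left conditions on the opposite ring, which is again a product of matrix
    -- rings, over $R^{\mathrm{op}}$.
    IsNoetherianRing.iff_of_ringEquiv_pi_matrix e.opPiMatrix,
    IsArtinianRing.iff_of_ringEquiv_pi_matrix e,
    IsArtinianRing.iff_of_ringEquiv_pi_matrix e.opPiMatrix⟩
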